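/- Let $s\in(0,1)$, let $N\ge 1$ be an integer with $N>2s$, and let $\Omega\subset\mathbb{R}^N$ be a bounded domain with $C^2$ boundary. Let $\gamma\in(0,1)$, $0<b<\min\{N,4s\}$, $\alpha,\lambda,\beta>0$, and put $2_s^*=\frac{2N}{N-2s}$, $2_b^*=\frac{2N-b}{N-2s}$. For $0<\sigma<1$ and $1\le p<\infty$ let $$[u]_{\sigma,p}^p=\int_{\mathbb{R}^{2N}}\frac{|u(x)-u(y)|^p}{|x-y|^{N+\sigma p}}\,dx\,dy,$$ and let $W_0^{\sigma,p}(\Omega)$ be the space of all $u\in L^p(\mathbb{R}^N)$ with $[u]_{\sigma,p}<\infty$ and $u=0$ a.e. in $\mathbb{R}^N\setminus\Omega$, with norm $\|u\|_{W_0^{\sigma,p}(\Omega)}=[u]_{\sigma,p}$; write $H_0^s(\Omega)=W_0^{s,2}(\Omega)$. Let $(\mu_n)_{n\ge1}\subset L^\infty(\Omega)$ be a sequence that is bounded in $L^1(\Omega)$. Fix a constant $\kappa>0$ (the normalization constant of the quadratic form of $(-\Delta)^s$; for instance $\kappa=1$). For $n\ge1$, a function $u_n\in H_0^s(\Omega)$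 is called a weak solution of $$(-\Delta)^su_n-\alpha\frac{u_n}{|x|^{2s}}=\lambda u_n+\frac{1}{(u_n+\frac1n)^\gamma}+\beta\left(\int_\Omega\frac{u_n^{2_b^*}(y)}{|x-y|^b}\,dy\right)u_n^{2_b^*-1}+\mu_n\ \text{ in }\Omega,\qquad u_n>0\ \text{ in }\Omega,\qquad u_n=0\ \text{ in }\mathbb{R}^N\setminus\Omega,\tag{$P_{\beta,n}$}$$ if for every $\phi\in C_c^\infty(\Omega)$ $$\kappa\int_{\mathbb{R}^{2N}}\frac{(u_n(x)-u_n(y))(\phi(x)-\phi(y))}{|x-y|^{N+2s}}\,dx\,dy-\alpha\int_\Omega\frac{u_n\phi}{|x|^{2s}}\,dx=\lambda\int_\Omega u_n\phi\,dx+\int_\Omega\frac{\phi}{(u_n+\frac1n)^\gamma}\,dx+\beta\int_\Omega\int_\Omega\frac{u_n^{2_b^*}(y)\,u_n^{2_b^*-1}(x)\,\phi(x)}{|x-y|^b}\,dx\,dy+\int_\Omega\mu_n\phi\,dx,$$ and if for every compact $K\subset\Omega$ there is a constant $c_K>0$ (which may depend on $n$) with $u_n\ge c_K$ a.e. in $K$.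 For every $n\ge 1$ let $u_n$ be a weak solution of $(P_{\beta,n})$ with $\|u_n\|_{L^{2_s^*}(\Omega)}=1$. Then, for every $\bar s\in(0,s)$ and every $m\in\left[1,\frac{N}{N-s}\right)$, the sequence $(u_n)_{n\ge1}$ is contained and bounded in $W_0^{\bar s,m}(\Omega)$: there is a constant $C$ such that $u_n\in W_0^{\bar s,m}(\Omega)$ and $\|u_n\|_{W_0^{\bar s,m}(\Omega)}\le C$ for all $n\ge1$. -/

import Mathlib

open MeasureTheory Set
open scoped ENNReal ContDiff Topology

noncomputable section

namespace FracChoquard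

/-- Euclidean space `ℝ^N`. -/
abbrev RN (N : ℕ) : Type := EuclideanSpace ℝ (Fin N)

/-- The critical Sobolev exponent `2_s^* = 2N / (N - 2s)`. -/
def twoStar (N : ℕ) (s : ℝ) : ℝ := 2 * N / (N - 2 * s)

/-- The critical Hardy-Littlewood-Sobolev exponent `2_b^* = (2N - b) / (N - 2s)`. -/
def twoStarB (N : ℕ) (s b : ℝ) : ℝ := (2 * N - b) / (N - 2 * s)

/-- The Gagliardo energy `∫_{ℝ^{2N}} |u(x) - u(y)|^p / |x - y|^{N + σ p} dx dy`,
as an extended nonnegative real. -/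
def gagliardo {N : ℕ} (σ p : ℝ) (u : RN N → ℝ) : ℝ≥0∞ :=
  ∫⁻ z : RN N × RN N,
    ENNReal.ofReal (|u z.1 - u z.2| ^ p / ‖z.1 - z.2‖ ^ ((N : ℝ) + σ * p))

/-- `u ∈ W_0^{σ,p}(Ω)`: `u ∈ L^p(ℝ^N)`, the Gagliardo energy of `u` is finite and `u = 0`
(almost everywhere) outside `Ω`. -/
structure MemW0 {N : ℕ} (Ω : Set (RN N)) (σ p : ℝ) (u : RN N → ℝ) : Prop where
  memLp : MemLp u (ENNReal.ofReal p) volume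
  gagliardo_lt_top : gagliardo σ p u < ⊤
  zero_outside : ∀ᵐ x : RN N, x ∉ Ω → u x = 0

/-- The norm of `W_0^{σ,p}(Ω)`. -/
def normW0 {N : ℕ} (σ p : ℝ) (u : RN N → ℝ) : ℝ≥0∞ :=
  gagliardo σ p u ^ (1 / p)

/-- `∂Ω` is of class `C^2`: near each boundary point, `Ω` is the sublevel set `{ρ < 0}` of a
`C^2` function `ρ` whose differential does not vanish at that point. -/
def HasC2Boundary {N : ℕ} (Ω : Set (RN N)) : Prop :=
  ∀ p ∈ frontier Ω, ∃ U : Set (RN N), IsOpen U ∧ p ∈ U ∧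
    ∃ ρ : RN N → ℝ, ContDiffOn ℝ 2 ρ U ∧ fderiv ℝ ρ p ≠ 0 ∧
      Ω ∩ U = {x | x ∈ U ∧ ρ x < 0}

/-- `φ ∈ C_c^∞(Ω)`. -/
structure IsTestFunction {N : ℕ} (Ω : Set (RN N)) (φ : RN N → ℝ) : Prop where
  contDiff : ContDiff ℝ ∞ φ
  hasCompactSupport : HasCompactSupport φ
  tsupport_subset : tsupport φ ⊆ Ω

/-- The bilinear form of the fractional Laplacian,
`∫_{ℝ^{2N}} (u(x) - u(y)) (φ(x) - φ(y)) / |x - y|^{N + 2s} dx dy`. -/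
def fracForm {N : ℕ} (s : ℝ) (u φ : RN N → ℝ) : ℝ :=
  ∫ z : RN N × RN N,
    (u z.1 - u z.2) * (φ z.1 - φ z.2) / ‖z.1 - z.2‖ ^ ((N : ℝ) + 2 * s)

/-- `u` is a weak solution, for the index `n ≥ 1` and the datum `μn`, of
`(-Δ)^s u - α u / |x|^{2s} = λ u + (u + 1/n)^{-γ}
    + β (∫_Ω u(y)^{2_b^*} / |x - y|^b dy) u^{2_b^* - 1} + μn` in `Ω`,
`u > 0` in `Ω`, `u = 0` outside `Ω`.
The number `κ` is the normalization constant in the quadratic form of `(-Δ)^s`. -/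
structure IsWeakSolution {N : ℕ} (Ω : Set (RN N)) (κ s b γ α lam β : ℝ) (n : ℕ)
    (μn : RN N → ℝ) (u : RN N → ℝ) : Prop where
  memH : MemW0 Ω s 2 u
  weak_form : ∀ φ : RN N → ℝ, IsTestFunction Ω φ →
    κ * fracForm s u φ - α * (∫ x in Ω, u x * φ x / ‖x‖ ^ (2 * s)) =
      lam * (∫ x in Ω, u x * φ x)
      + (∫ x in Ω, φ x / (u x + 1 / (n : ℝ)) ^ γ)
      + β * (∫ z in Ω ×ˢ Ω,
          u z.2 ^ twoStarB N s b * u z.1 ^ (twoStarB N s b - 1) * φ z.1 / ‖z.1 - z.2‖ ^ b)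
      + (∫ x in Ω, μn x * φ x)
  locally_pos : ∀ K : Set (RN N), IsCompact K → K ⊆ Ω →
    ∃ c : ℝ, 0 < c ∧ ∀ᵐ x ∂(volume.restrict K), c ≤ u x

end FracChoquard

end

/-!
The equation is read as `κ (-Δ)^s u = f` with `f ∈ L^1(Ω)`, the Hardy term being moved to the
right, and tested with the bounded function `u / (1 + |u|)`. This test is admissible because `C^2`
domains satisfy an exterior corkscrew condition, hence a fractional Hardy inequality, so that
bounded functions of `H_0^s(Ω)` are limits of test functions obtained by a cutoff near the boundary
followed by mollification. Since `f u / (1 + |u|)` is bounded in `L^1(Ω)` in terms of the critical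
norm of `u` and the `L^1` norm of the datum, this bounds
`∫∫ |u(x) - u(y)|² / ((1 + |u(x)|) (1 + |u(y)|) |x - y|^{N + 2s})` uniformly. By Young's inequality
with exponents `2 / m` and `2 / (2 - m)`, this bound and the `L^{2_s^*}` bound control the
`W^{σ,m}` seminorm: the weight produces `|u|^{2m / (2 - m)}`, which is subcritical iff
`m ≤ N / (N - s)`, and the gain `s - σ` makes the remaining kernel integrable.
-/

namespace FracChoquard

open Filter Metric

section Convergence

variable {X : Type*} [MeasurableSpace X] {μ : Measure X} {p q : ℝ≥0∞} [p.HolderConjugate q]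
  {g : X → ℝ} {f : ℕ → X → ℝ} {C : ℝ≥0∞}

lemma eLpNorm_indicator_smul_le_of_holderConjugate {f : X → ℝ} {s : Set X}
    (hs : MeasurableSet s) (hg : AEStronglyMeasurable g μ) (hf : AEStronglyMeasurable f μ) :
    eLpNorm (s.indicator (g • f)) 1 μ ≤ eLpNorm (s.indicator g) p μ * eLpNorm f q μ := by
  have h : s.indicator (g • f) = s.indicator g • f := by
    ext x
    by_cases hx : x ∈ s <;> simp [hx]
  rw [h]
  exact eLpNorm_smul_le_mul_eLpNorm hf (hg.indicator hs)

lemma unifIntegrable_smul_of_holderConjugate (hp : p ≠ ⊤) (hg : MemLp g p μ)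
    (hC : C ≠ ⊤) (hf : ∀ k, AEStronglyMeasurable (f k) μ) (hfC : ∀ k, eLpNorm (f k) q μ ≤ C) :
    UnifIntegrable (fun k => g • f k) 1 μ := by
  lift C to NNReal using hC
  intro ε hε
  obtain ⟨δ, hδ, hgδ⟩ := hg.eLpNorm_indicator_le (ENNReal.HolderConjugate.one_le p q) hp
    (div_pos hε (by positivity : 0 < (C : ℝ) + 1))
  refine ⟨δ, hδ, fun k s hs hsδ => ?_⟩
  calc eLpNorm (s.indicator (g • f k)) 1 μ
      ≤ eLpNorm (s.indicator g) p μ * eLpNorm (f k) q μ :=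
        eLpNorm_indicator_smul_le_of_holderConjugate hs hg.1 (hf k)
    _ ≤ ENNReal.ofReal (ε / (C + 1)) * ENNReal.ofReal C :=
        mul_le_mul' (hgδ s hs hsδ) (by simpa using hfC k)
    _ ≤ ENNReal.ofReal ε := by
        rw [← ENNReal.ofReal_mul (by positivity), div_mul_eq_mul_div]
        exact ENNReal.ofReal_le_ofReal (div_le_of_le_mul₀ (by positivity) hε.le (by nlinarith))

lemma unifTight_smul_of_holderConjugate (hp : p ≠ ⊤) (hg : MemLp g p μ)
    (hC : C ≠ ⊤) (hf : ∀ k, AEStronglyMeasurable (f k) μ) (hfC : ∀ k, eLpNorm (f k) q μ ≤ C) :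
    UnifTight (fun k => g • f k) 1 μ := by
  intro ε hε
  obtain ⟨s, hs, hμs, hgs⟩ := hg.exists_eLpNorm_indicator_compl_lt hp
    (ENNReal.div_pos (ENNReal.coe_ne_zero.2 hε.ne') hC).ne'
  exact ⟨s, hμs.ne, fun k =>
    (eLpNorm_indicator_smul_le_of_holderConjugate hs.compl hg.1 (hf k)).trans
      ((mul_le_mul' hgs.le (hfC k)).trans ((mul_comm _ _).trans_le ENNReal.mul_div_le))⟩

lemma tendsto_integral_mul_of_ae_tendsto (hp : p ≠ ⊤) (hg : MemLp g p μ) (hC : C ≠ ⊤)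
    (hf : ∀ k, AEStronglyMeasurable (f k) μ) (hfC : ∀ k, eLpNorm (f k) q μ ≤ C) {f₀ : X → ℝ}
    (hlim : ∀ᵐ x ∂μ, Tendsto (fun k => f k x) atTop (𝓝 (f₀ x))) :
    Tendsto (fun k => ∫ x, g x * f k x ∂μ) atTop (𝓝 (∫ x, g x * f₀ x ∂μ)) := by
  have hf₀ : MemLp f₀ q μ := ⟨aestronglyMeasurable_of_tendsto_ae atTop hf hlim,
    (Lp.eLpNorm_le_of_ae_tendsto (.of_forall hfC) hf hlim).trans_lt hC.lt_top⟩
  have hprod : ∀ {h : X → ℝ}, MemLp h q μ → MemLp (g • h) 1 μ := fun hh => hh.smul hg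
  have hfk : ∀ k, MemLp (f k) q μ := fun k => ⟨hf k, (hfC k).trans_lt hC.lt_top⟩
  have hL1 : Tendsto (fun k => eLpNorm (g • f k - g • f₀) 1 μ) atTop (𝓝 0) :=
    tendsto_Lp_of_tendsto_ae le_rfl ENNReal.one_ne_top (fun k => (hprod (hfk k)).1) (hprod hf₀)
      (unifIntegrable_smul_of_holderConjugate hp hg hC hf hfC)
      (unifTight_smul_of_holderConjugate hp hg hC hf hfC)
      (hlim.mono fun x hx => hx.const_mul (g x))
  exact tendsto_integral_of_L1' _ (hprod hf₀).1
    (.of_forall fun k => memLp_one_iff_integrable.1 (hprod (hfk k))) hL1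

end Convergence

section Kernels

variable {E : Type*} [NormedAddCommGroup E] [NormedSpace ℝ E] [FiniteDimensional ℝ E]
  [MeasurableSpace E] [BorelSpace E] (μ : Measure E) [μ.IsAddHaarMeasure]

lemma lintegral_ball_norm_rpow_neg_lt_top [Nontrivial E] {a : ℝ} (ha : a < Module.finrank ℝ E)
    (R : ℝ) : ∫⁻ x in ball (0 : E) R, ENNReal.ofReal (‖x‖ ^ (-a)) ∂μ < ⊤ :=
  (integrableOn_ball_of_norm_le_rpow (C := 1) Module.finrank_pos ha
    (.of_forall fun x => by simp [abs_of_nonneg (Real.rpow_nonneg (norm_nonneg x) _)])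
    (measurable_norm.pow_const _).aestronglyMeasurable).setLIntegral_lt_top

lemma lintegral_compl_ball_norm_rpow_neg_lt_top {b : ℝ} (hb : Module.finrank ℝ E < b) :
    ∫⁻ x in (ball (0 : E) 1)ᶜ, ENNReal.ofReal (‖x‖ ^ (-b)) ∂μ < ⊤ := by
  have : 0 < b := (Nat.cast_nonneg _).trans_lt hb
  have hint : ∫⁻ x : E, ENNReal.ofReal (2 ^ b * (1 + ‖x‖) ^ (-b)) ∂μ < ⊤ :=
    ((integrable_one_add_norm hb).const_mul _).lintegral_lt_top
  refine (setLIntegral_mono' measurableSet_ball.compl fun x hx => ?_).trans_lt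
    ((setLIntegral_le_lintegral _ _).trans_lt hint)
  have hx1 : 1 ≤ ‖x‖ := by simpa using hx
  refine ENNReal.ofReal_le_ofReal ?_
  calc ‖x‖ ^ (-b) ≤ ((1 + ‖x‖) / 2) ^ (-b) :=
        Real.rpow_le_rpow_of_nonpos (by positivity) (by linarith) (by linarith)
    _ = 2 ^ b * (1 + ‖x‖) ^ (-b) := by
        rw [Real.div_rpow (by positivity) two_pos.le, Real.rpow_neg two_pos.le b, div_inv_eq_mul,
          mul_comm]

lemma lintegral_min_norm_rpow_neg_lt_top [Nontrivial E] {a b : ℝ} (ha : a < Module.finrank ℝ E)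
    (hb : Module.finrank ℝ E < b) :
    ∫⁻ x : E, ENNReal.ofReal (min (‖x‖ ^ (-a)) (‖x‖ ^ (-b))) ∂μ < ⊤ := by
  rw [← lintegral_add_compl _ (measurableSet_ball (x := (0 : E)) (ε := 1))]
  refine ENNReal.add_lt_top.2 ⟨?_, ?_⟩
  · exact (lintegral_mono fun x => ENNReal.ofReal_le_ofReal (min_le_left _ _)).trans_lt
      (lintegral_ball_norm_rpow_neg_lt_top μ ha 1)
  · exact (lintegral_mono fun x => ENNReal.ofReal_le_ofReal (min_le_right _ _)).trans_lt
      (lintegral_compl_ball_norm_rpow_neg_lt_top μ hb)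

end Kernels

section Tonelli

variable {G : Type*} [AddCommGroup G] [MeasurableSpace G] [MeasurableAdd₂ G] [MeasurableNeg G]
  {μ : Measure G} [SFinite μ] [μ.IsAddLeftInvariant]
  {f k : G → ℝ≥0∞}

lemma lintegral_prod_fst_mul_sub [μ.IsNegInvariant] (hf : AEMeasurable f μ) (hk : Measurable k) :
    ∫⁻ z : G × G, f z.1 * k (z.1 - z.2) ∂μ.prod μ = (∫⁻ x, f x ∂μ) * ∫⁻ h, k h ∂μ := by
  rw [lintegral_prod _ (by fun_prop), ← lintegral_mul_const'' _ hf]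
  refine lintegral_congr fun x => ?_
  dsimp only
  rw [lintegral_const_mul _ (by fun_prop), lintegral_sub_left_eq_self]

lemma lintegral_prod_snd_mul_sub (hf : AEMeasurable f μ) (hk : Measurable k) :
    ∫⁻ z : G × G, f z.2 * k (z.1 - z.2) ∂μ.prod μ = (∫⁻ x, f x ∂μ) * ∫⁻ h, k h ∂μ := by
  rw [lintegral_prod_symm _ (by fun_prop), ← lintegral_mul_const'' _ hf]
  refine lintegral_congr fun x => ?_
  dsimp only
  rw [lintegral_const_mul _ (by fun_prop), lintegral_sub_right_eq_self]

end Tonelli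

/-- The exterior corkscrew condition: every ball of small radius `r` centred on `∂Ω` comes with a
ball of radius comparable to `r`, centred in it and contained in the complement of `Ω`. A single
constant `ε` serves as comparison constant and as bound for the admissible radii. -/
def HasExteriorCorkscrew {X : Type*} [PseudoMetricSpace X] (Ω : Set X) : Prop :=
  ∃ ε > 0, ∀ q ∈ frontier Ω, ∀ r ∈ Ioc 0 ε, ∃ z ∈ closedBall q r, ball z (ε * r) ⊆ Ωᶜ

section Corkscrew

variable {X : Type*} [PseudoMetricSpace X] {Ω : Set X}

lemma hasExteriorCorkscrew_of_forall_frontier (hΩ : IsCompact (frontier Ω))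
    (h : ∀ p ∈ frontier Ω, ∃ ε > 0, ∀ q ∈ frontier Ω ∩ ball p ε, ∀ r ∈ Ioc 0 ε,
      ∃ z ∈ closedBall q r, ball z (ε * r) ⊆ Ωᶜ) : HasExteriorCorkscrew Ω := by
  suffices H : ∃ ε > 0, ∀ q ∈ frontier Ω ∩ frontier Ω, ∀ r ∈ Ioc 0 ε,
      ∃ z ∈ closedBall q r, ball z (ε * r) ⊆ Ωᶜ by rwa [inter_self] at H
  refine hΩ.induction_on (p := fun S => ∃ ε > 0, ∀ q ∈ frontier Ω ∩ S, ∀ r ∈ Ioc 0 ε,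
    ∃ z ∈ closedBall q r, ball z (ε * r) ⊆ Ωᶜ) ⟨1, one_pos, by simp⟩ ?_ ?_ ?_
  · rintro S T hST ⟨ε, hε, h⟩
    exact ⟨ε, hε, fun q hq => h q ⟨hq.1, hST hq.2⟩⟩
  · have shrink {ε ε' r : ℝ} {z : X} (hr : 0 < r) (hε : ε ≤ ε')
        (hz : ball z (ε' * r) ⊆ Ωᶜ) : ball z (ε * r) ⊆ Ωᶜ :=
      (ball_subset_ball (by gcongr)).trans hz
    rintro S T ⟨ε, hε, h⟩ ⟨ε', hε', h'⟩
    refine ⟨min ε ε', lt_min hε hε', ?_⟩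
    rintro q ⟨hq, hqS | hqT⟩ r ⟨hr, hrε⟩
    · obtain ⟨z, hz, hzΩ⟩ := h q ⟨hq, hqS⟩ r ⟨hr, hrε.trans (min_le_left _ _)⟩
      exact ⟨z, hz, shrink hr (min_le_left _ _) hzΩ⟩
    · obtain ⟨z, hz, hzΩ⟩ := h' q ⟨hq, hqT⟩ r ⟨hr, hrε.trans (min_le_right _ _)⟩
      exact ⟨z, hz, shrink hr (min_le_right _ _) hzΩ⟩
  · intro p hp
    obtain ⟨ε, hε, h⟩ := h p hp
    exact ⟨ball p ε, mem_nhdsWithin_of_mem_nhds (ball_mem_nhds p hε), ε, hε, h⟩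

end Corkscrew

section Derivative

variable {E : Type*} [NormedAddCommGroup E] [NormedSpace ℝ E] {L : E →L[ℝ] ℝ}

lemma exists_norm_lt_one_apply_pos (hL : L ≠ 0) : ∃ ν, ‖ν‖ < 1 ∧ 0 < L ν := by
  obtain ⟨ν, hν, hLν⟩ := L.exists_lt_apply_of_lt_opNorm (norm_pos_iff.2 hL)
  rcases (norm_pos_iff.1 hLν).lt_or_gt with h | h
  · exact ⟨-ν, by rwa [norm_neg], by simpa using h⟩
  · exact ⟨ν, hν, h⟩

lemma exists_forall_mem_ball_lt_of_hasStrictFDerivAt {ρ : E → ℝ} {p ν : E} {U : Set E}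
    (hρ : HasStrictFDerivAt ρ L p) (hν : 0 < L ν) (hU : U ∈ 𝓝 p) :
    ∃ ε > 0, ∀ q ∈ ball p ε, ∀ t ∈ Ioc 0 ε, ∀ y ∈ ball (q + t • ν) (ε * t),
      q ∈ U ∧ y ∈ U ∧ ρ q < ρ y := by
  obtain ⟨δ, hδ, hball⟩ := Metric.eventually_nhds_iff_ball.1
    ((hρ.isLittleO.bound (show 0 < L ν / (4 * (‖ν‖ + 1)) by positivity)).and
      (prod_mem_nhds hU hU))
  set ε := min 1 (min (L ν / (4 * (‖L‖ + 1))) (δ / (‖ν‖ + 2)))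
  have hε1 : ε ≤ 1 := min_le_left _ _
  have hεL : ε * (4 * (‖L‖ + 1)) ≤ L ν :=
    (le_div_iff₀ (by positivity)).1 ((min_le_right _ _).trans (min_le_left _ _))
  have hεδ : ε * (‖ν‖ + 2) ≤ δ :=
    (le_div_iff₀ (by positivity)).1 ((min_le_right _ _).trans (min_le_right _ _))
  refine ⟨ε, by positivity, fun q hq t ⟨ht, htε⟩ y hy => ?_⟩
  have hyq' : ‖y - q - t • ν‖ ≤ ε * t := by
    rw [mem_ball, dist_eq_norm, ← sub_sub] at hy
    exact hy.le
  have hyq : ‖y - q‖ ≤ t * (‖ν‖ + 1) := by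
    have := norm_le_norm_add_norm_sub' (y - q) (t • ν)
    rw [norm_smul, Real.norm_of_nonneg ht.le] at this
    nlinarith
  have hqp : dist q p < ε := hq
  have hyp : dist y p < δ := by
    have := dist_triangle y q p
    rw [dist_eq_norm y q] at this
    nlinarith [norm_nonneg ν]
  have hqδ : dist q p < δ := by nlinarith [norm_nonneg ν, dist_nonneg (x := q) (y := p)]
  obtain ⟨hlin, hyU, hqU⟩ := hball (y, q) (by rw [mem_ball, Prod.dist_eq]; exact max_lt hyp hqδ)
  refine ⟨hqU, hyU, ?_⟩
  have hL : L (y - q) = t * L ν + L (y - q - t • ν) := by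
    rw [map_sub L (y - q), map_smul, smul_eq_mul]; ring
  have hLerr : |L (y - q - t • ν)| ≤ L ν / 4 * t := by
    refine (L.le_opNorm _).trans ?_
    nlinarith [norm_nonneg L, mul_le_mul_of_nonneg_left hyq' (norm_nonneg L)]
  have hρerr : |ρ y - ρ q - L (y - q)| ≤ L ν / 4 * t := by
    refine hlin.trans ((mul_le_mul_of_nonneg_left hyq (by positivity)).trans_eq ?_)
    field_simp
  nlinarith [neg_le_of_abs_le hLerr, neg_le_of_abs_le hρerr, mul_pos ht hν]

end Derivative

lemma HasC2Boundary.hasExteriorCorkscrew {N : ℕ} {Ω : Set (RN N)} (hΩo : IsOpen Ω)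
    (hΩb : Bornology.IsBounded Ω) (hΩ : HasC2Boundary Ω) : HasExteriorCorkscrew Ω := by
  refine hasExteriorCorkscrew_of_forall_frontier (isCompact_of_isClosed_isBounded
    isClosed_frontier (hΩb.closure.subset frontier_subset_closure)) fun p hp => ?_
  obtain ⟨U, hU, hpU, ρ, hρ, hL, hΩU⟩ := hΩ p hp
  have hmem : ∀ x ∈ U, x ∈ Ω ↔ ρ x < 0 := fun x hx =>
    ⟨fun h => (hΩU.subset ⟨h, hx⟩).2, fun h => (hΩU.superset ⟨hx, h⟩).1⟩
  have hd : HasStrictFDerivAt ρ (fderiv ℝ ρ p) p :=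
    (hρ.contDiffAt (hU.mem_nhds hpU)).hasStrictFDerivAt two_ne_zero
  obtain ⟨ν, hν1, hν⟩ := exists_norm_lt_one_apply_pos hL
  obtain ⟨ε, hε, hlt⟩ := exists_forall_mem_ball_lt_of_hasStrictFDerivAt hd hν (hU.mem_nhds hpU)
  refine ⟨ε, hε, fun q ⟨hqf, hqp⟩ r hr => ⟨q + r • ν, ?_, fun y hy hyΩ => ?_⟩⟩
  · rw [mem_closedBall, dist_eq_norm, add_sub_cancel_left, norm_smul, Real.norm_of_nonneg hr.1.le]
    exact mul_le_of_le_one_right hr.1.le hν1.le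
  · obtain ⟨hqU, hyU, hρ⟩ := hlt q hqp r hr y hy
    have hqΩ : q ∉ Ω := (hΩo.frontier_eq ▸ hqf).2
    exact hqΩ ((hmem q hqU).2 (hρ.trans ((hmem y hyU).1 hyΩ)))

section Hardy

variable {E : Type*} [NormedAddCommGroup E] [NormedSpace ℝ E] {Ω : Set E}

lemma compl_nonempty_of_isBounded [Nontrivial E] (hΩb : Bornology.IsBounded Ω) :
    Ωᶜ.Nonempty :=
  nonempty_compl.2 fun h => NormedSpace.unbounded_univ ℝ E (h ▸ hΩb)

lemma infDist_compl_pos [Nontrivial E] (hΩo : IsOpen Ω) (hΩb : Bornology.IsBounded Ω) {y : E}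
    (hy : y ∈ Ω) : 0 < infDist y Ωᶜ :=
  (hΩo.isClosed_compl.notMem_iff_infDist_pos (compl_nonempty_of_isBounded hΩb)).1
    (notMem_compl_iff.2 hy)

variable [FiniteDimensional ℝ E]

lemma exists_mem_frontier_dist_eq_infDist_compl [Nontrivial E] (hΩo : IsOpen Ω)
    (hΩb : Bornology.IsBounded Ω) {y : E} (hy : y ∈ Ω) :
    ∃ q ∈ frontier Ω, dist q y = infDist y Ωᶜ := by
  have := FiniteDimensional.proper_real E
  obtain ⟨q, hq, hqd⟩ :=
    hΩo.isClosed_compl.exists_infDist_eq_dist (compl_nonempty_of_isBounded hΩb) y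
  have hqd' : dist q y = infDist y Ωᶜ := by rw [dist_comm, hqd]
  have hqΩ : q ∈ closure Ω := by
    refine closure_mono (ball_infDist_compl_subset (x := y)) ?_
    rw [closure_ball y (infDist_compl_pos hΩo hΩb hy).ne']
    exact hqd'.le
  exact ⟨q, hΩo.frontier_eq ▸ ⟨hqΩ, hq⟩, hqd'⟩

namespace HasExteriorCorkscrew

lemma exists_ball_subset_compl_inter_closedBall [Nontrivial E] (hΩo : IsOpen Ω)
    (hΩb : Bornology.IsBounded Ω) (hΩ : HasExteriorCorkscrew Ω) :
    ∃ ε > 0, ∀ y ∈ Ω, ∃ z,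
      ball z (ε * infDist y Ωᶜ) ⊆ Ωᶜ ∩ closedBall y (3 * infDist y Ωᶜ) := by
  obtain ⟨ε, hε, h⟩ := hΩ
  obtain ⟨e, he⟩ := compl_nonempty_of_isBounded hΩb
  obtain ⟨D, hD, hΩD⟩ : ∃ D > 0, Ω ⊆ closedBall e D := by
    obtain ⟨R, hR⟩ := hΩb.subset_closedBall e
    exact ⟨max R 1, by positivity, hR.trans (closedBall_subset_closedBall (le_max_left _ _))⟩
  set c := min 1 (ε / D)
  refine ⟨min 1 (ε * c), by positivity, fun y hy => ?_⟩
  obtain ⟨q, hqf, hqy⟩ := exists_mem_frontier_dist_eq_infDist_compl hΩo hΩb hy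
  have hd := infDist_compl_pos hΩo hΩb hy
  have hdD : infDist y Ωᶜ ≤ D := (infDist_le_dist_of_mem he).trans (hΩD hy)
  set d := infDist y Ωᶜ
  have hcd : c * d ≤ ε :=
    calc c * d ≤ ε / D * D := by gcongr; exact min_le_right _ _
      _ = ε := div_mul_cancel₀ _ hD.ne'
  have hcd' : c * d ≤ d := mul_le_of_le_one_left hd.le (min_le_left _ _)
  obtain ⟨z, hz, hzΩ⟩ := h q hqf (c * d) ⟨by positivity, hcd⟩
  refine ⟨z, subset_inter ((ball_subset_ball ?_).trans hzΩ) fun w hw => ?_⟩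
  · rw [← mul_assoc]
    gcongr
    exact min_le_right _ _
  · have hwz : dist w z ≤ d :=
      (mem_ball.1 hw).le.trans (mul_le_of_le_one_left hd.le (min_le_left _ _))
    have hzq : dist z q ≤ d := (mem_closedBall.1 hz).trans hcd'
    rw [mem_closedBall]
    linarith [dist_triangle4 w z q y]

lemma exists_infDist_rpow_neg_le_lintegral_compl [Nontrivial E] [MeasurableSpace E]
    [BorelSpace E] (μ : Measure E) [μ.IsAddHaarMeasure] (hΩo : IsOpen Ω)
    (hΩb : Bornology.IsBounded Ω) (hΩ : HasExteriorCorkscrew Ω) {τ : ℝ} (hτ : 0 ≤ τ) :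
    ∃ C : ℝ≥0∞, C ≠ ⊤ ∧ ∀ y ∈ Ω, ENNReal.ofReal (infDist y Ωᶜ ^ (-τ)) ≤
      C * ∫⁻ z in Ωᶜ, ENNReal.ofReal (1 / ‖y - z‖ ^ (Module.finrank ℝ E + τ)) ∂μ := by
  obtain ⟨ε, hε, h⟩ := hΩ.exists_ball_subset_compl_inter_closedBall hΩo hΩb
  set n : ℝ := (Module.finrank ℝ E : ℝ)
  set A : ℝ≥0∞ := ENNReal.ofReal ((3 : ℝ) ^ (-(n + τ)) * ε ^ n) * μ (ball 0 1) with hA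
  have hA0 : A ≠ 0 := mul_ne_zero (ENNReal.ofReal_pos.2 (by positivity)).ne'
    (measure_ball_pos _ _ one_pos).ne'
  have hAt : A ≠ ⊤ := ENNReal.mul_ne_top ENNReal.ofReal_ne_top measure_ball_lt_top.ne
  refine ⟨A⁻¹, ENNReal.inv_ne_top.2 hA0, fun y hy => ?_⟩
  have hd := infDist_compl_pos hΩo hΩb hy
  obtain ⟨z, hz⟩ := h y hy
  set d := infDist y Ωᶜ
  rw [mul_comm, ← div_eq_mul_inv, ENNReal.le_div_iff_mul_le (.inl hA0) (.inl hAt), mul_comm]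
  calc A * ENNReal.ofReal (d ^ (-τ))
      = ∫⁻ _ in ball z (ε * d), ENNReal.ofReal ((3 * d) ^ (-(n + τ))) ∂μ := by
        rw [lintegral_const, Measure.restrict_apply_univ, Measure.addHaar_ball _ _ (by positivity),
          hA, mul_right_comm, ← mul_assoc, ← ENNReal.ofReal_mul (by positivity),
          ← ENNReal.ofReal_mul (by positivity), ← Real.rpow_natCast]
        congr 2
        rw [Real.mul_rpow (by norm_num) hd.le, Real.mul_rpow hε.le hd.le,
          show -τ = -(n + τ) + n by ring, Real.rpow_add hd]
        ring
    _ ≤ ∫⁻ w in ball z (ε * d), ENNReal.ofReal (1 / ‖y - w‖ ^ (n + τ)) ∂μ := by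
        refine setLIntegral_mono' measurableSet_ball fun w hw => ENNReal.ofReal_le_ofReal ?_
        obtain ⟨hwΩ, hwd⟩ := hz hw
        rw [mem_closedBall, dist_comm, dist_eq_norm] at hwd
        have : 0 < ‖y - w‖ := norm_sub_pos_iff.2 (ne_of_mem_of_not_mem hy hwΩ)
        rw [Real.rpow_neg (by positivity), ← one_div]
        gcongr
    _ ≤ _ := lintegral_mono_set fun w hw => (hz hw).1

end HasExteriorCorkscrew

end Hardy

section Cutoff

/-- The profile of the cutoffs near the boundary: it vanishes on `(-∞, 1 / k]` and equals `1` on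
`[2 / k, ∞)`, for `0 < k`. -/
noncomputable def cutoffProfile (k t : ℝ) : ℝ := min 1 (max 0 (k * t - 1))

variable {k : ℝ}

lemma cutoffProfile_nonneg (k t : ℝ) : 0 ≤ cutoffProfile k t := le_min zero_le_one (le_max_left _ _)

lemma cutoffProfile_le_one (k t : ℝ) : cutoffProfile k t ≤ 1 := min_le_left _ _

lemma cutoffProfile_of_mul_le_one {t : ℝ} (h : k * t ≤ 1) : cutoffProfile k t = 0 := by
  rw [cutoffProfile, max_eq_left (by linarith), min_eq_right zero_le_one]

lemma cutoffProfile_of_two_le_mul {t : ℝ} (h : 2 ≤ k * t) : cutoffProfile k t = 1 := by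
  rw [cutoffProfile, max_eq_right (by linarith), min_eq_left (by linarith)]

lemma continuous_cutoffProfile (k : ℝ) : Continuous (cutoffProfile k) := by
  unfold cutoffProfile; fun_prop

lemma abs_cutoffProfile_sub_le_one (k a b : ℝ) :
    |cutoffProfile k a - cutoffProfile k b| ≤ 1 :=
  abs_sub_le_iff.2
    ⟨by linarith [cutoffProfile_le_one k a, cutoffProfile_nonneg k b],
      by linarith [cutoffProfile_le_one k b, cutoffProfile_nonneg k a]⟩

lemma abs_cutoffProfile_sub_le_mul (hk : 0 ≤ k) (a b : ℝ) :
    |cutoffProfile k a - cutoffProfile k b| ≤ k * |a - b| :=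
  calc |cutoffProfile k a - cutoffProfile k b|
      ≤ |max 0 (k * a - 1) - max 0 (k * b - 1)| := by
        simpa [cutoffProfile] using
          abs_min_sub_min_le_max 1 (max 0 (k * a - 1)) 1 (max 0 (k * b - 1))
    _ ≤ |(k * a - 1) - (k * b - 1)| := by
        simpa [max_comm] using abs_max_sub_max_le_abs (k * a - 1) (k * b - 1) 0
    _ = k * |a - b| := by rw [sub_sub_sub_cancel_right, ← mul_sub, abs_mul, abs_of_nonneg hk]

lemma abs_cutoffProfile_sub_le {a b : ℝ} (hk : 0 ≤ k) (hb : 0 < b) :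
    |cutoffProfile k a - cutoffProfile k b| ≤ min 1 (4 * |a - b| / b) := by
  refine le_min (abs_cutoffProfile_sub_le_one k a b) ?_
  rw [le_div_iff₀ hb]
  rcases le_total (b / 2) |a - b| with h | h
  · nlinarith [abs_cutoffProfile_sub_le_one k a b]
  rcases le_total 4 (k * b) with hkb | hkb
  · have hka : 2 ≤ k * a := by nlinarith [neg_le_of_abs_le h]
    rw [cutoffProfile_of_two_le_mul hka, cutoffProfile_of_two_le_mul (by linarith : 2 ≤ k * b),
      sub_self, abs_zero, zero_mul]
    positivity
  · nlinarith [abs_cutoffProfile_sub_le_mul hk a b, abs_nonneg (a - b)]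

end Cutoff

section RealInequalities

lemma add_rpow_le_two_rpow_mul {x y p : ℝ} (hx : 0 ≤ x) (hy : 0 ≤ y) (hp : 0 ≤ p) :
    (x + y) ^ p ≤ 2 ^ p * (x ^ p + y ^ p) :=
  calc (x + y) ^ p ≤ (2 * max x y) ^ p := by
        gcongr
        linarith [le_max_left x y, le_max_right x y]
    _ = 2 ^ p * max x y ^ p := Real.mul_rpow two_pos.le (le_max_of_le_left hx)
    _ ≤ 2 ^ p * (x ^ p + y ^ p) := by
        gcongr
        rcases max_choice x y with h | h <;> rw [h]
        · exact le_add_of_nonneg_right (by positivity)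
        · exact le_add_of_nonneg_left (by positivity)

lemma min_one_div_rpow_div_rpow_le {d t p b : ℝ} (hd : 0 < d) (ht : 0 ≤ t) (hp : 0 ≤ p)
    (hb : 0 < b) :
    min 1 (4 * t / d) ^ p / t ^ b ≤ 4 ^ p * min (d ^ (-p) * t ^ (p - b)) (t ^ (-b)) := by
  rcases ht.eq_or_lt with rfl | ht
  · rw [Real.zero_rpow hb.ne', div_zero]
    positivity
  rw [mul_min_of_nonneg _ _ (by positivity)]
  refine le_min ?_ ?_
  · calc min 1 (4 * t / d) ^ p / t ^ b ≤ (4 * t / d) ^ p / t ^ b := by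
          gcongr; exact min_le_right _ _
      _ = 4 ^ p * (d ^ (-p) * t ^ (p - b)) := by
          rw [Real.div_rpow (by positivity) hd.le, Real.mul_rpow (by norm_num) ht.le,
            Real.rpow_neg hd.le, Real.rpow_sub ht]
          ring
  · calc min 1 (4 * t / d) ^ p / t ^ b ≤ 1 / t ^ b := by
          gcongr
          exact Real.rpow_le_one (by positivity) (min_le_left _ _) hp
      _ = t ^ (-b) := by rw [Real.rpow_neg ht.le, one_div]
      _ ≤ 4 ^ p * t ^ (-b) :=
          le_mul_of_one_le_left (by positivity) (Real.one_le_rpow (by norm_num) hp)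

end RealInequalities

section Scaling

variable {E : Type*} [NormedAddCommGroup E] [NormedSpace ℝ E] [FiniteDimensional ℝ E]
  [MeasurableSpace E] [BorelSpace E] (μ : Measure E) [μ.IsAddHaarMeasure]

lemma lintegral_comp_inv_smul {f : E → ℝ≥0∞} (hf : Measurable f) {d : ℝ} (hd : 0 < d) :
    ∫⁻ x, f (d⁻¹ • x) ∂μ = ENNReal.ofReal (d ^ Module.finrank ℝ E) * ∫⁻ x, f x ∂μ := by
  have h := lintegral_map (μ := μ) hf (measurable_const_smul (d⁻¹ : ℝ))
  rw [Measure.map_addHaar_smul _ (inv_ne_zero hd.ne'), lintegral_smul_measure] at h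
  rw [← h, smul_eq_mul, inv_pow, inv_inv, abs_of_pos (by positivity)]

lemma lintegral_min_mul_norm_rpow_eq {d : ℝ} (hd : 0 < d) (p b : ℝ) :
    ∫⁻ x, ENNReal.ofReal (min (d ^ (-p) * ‖x‖ ^ (p - b)) (‖x‖ ^ (-b))) ∂μ =
      ENNReal.ofReal (d ^ (Module.finrank ℝ E - b)) *
        ∫⁻ x, ENNReal.ofReal (min (‖x‖ ^ (p - b)) (‖x‖ ^ (-b))) ∂μ := by
  rw [sub_eq_neg_add (Module.finrank ℝ E : ℝ) b, Real.rpow_add hd, Real.rpow_natCast,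
    ENNReal.ofReal_mul (by positivity), mul_assoc, ← lintegral_comp_inv_smul μ (by fun_prop) hd,
    ← lintegral_const_mul' _ _ ENNReal.ofReal_ne_top]
  refine lintegral_congr fun x => ?_
  have hscale (e : ℝ) : ‖d⁻¹ • x‖ ^ e = d ^ (-e) * ‖x‖ ^ e := by
    rw [norm_smul, norm_inv, Real.norm_of_nonneg hd.le,
      Real.mul_rpow (by positivity) (norm_nonneg x), Real.inv_rpow hd.le, Real.rpow_neg hd.le]
  rw [← ENNReal.ofReal_mul (by positivity), mul_min_of_nonneg _ _ (by positivity), hscale, hscale,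
    ← mul_assoc, ← mul_assoc, ← Real.rpow_add hd, ← Real.rpow_add hd,
    show -b + -(p - b) = -p by ring, show -b + -(-b) = 0 by ring, Real.rpow_zero, one_mul]

end Scaling

section FractionalHardy

variable {N : ℕ} {Ω : Set (RN N)} {σ p : ℝ} {v : RN N → ℝ}

lemma gagliardo_eq_lintegral_lintegral (hv : Measurable v) :
    gagliardo σ p v =
      ∫⁻ y, ∫⁻ z, ENNReal.ofReal (|v y - v z| ^ p / ‖y - z‖ ^ ((N : ℝ) + σ * p)) := by
  rw [gagliardo, Measure.volume_eq_prod, lintegral_prod _ (by fun_prop)]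

namespace HasExteriorCorkscrew

variable [NeZero N]

/- Since `v` vanishes outside `Ω`, the energy contains the integral over `y ∈ Ω`, `z ∉ Ω` of
`|v y|^p / |y - z|^(N + σ p)`, in which `z` ranges over a corkscrew ball. -/
lemma exists_lintegral_rpow_mul_infDist_rpow_neg_le (hΩo : IsOpen Ω)
    (hΩb : Bornology.IsBounded Ω) (hΩ : HasExteriorCorkscrew Ω) (hσ : 0 ≤ σ) (hp : 0 < p) :
    ∃ C : ℝ≥0∞, C ≠ ⊤ ∧ ∀ v : RN N → ℝ, Measurable v → (∀ᵐ x, x ∉ Ω → v x = 0) →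
      ∫⁻ y in Ω, ENNReal.ofReal (|v y| ^ p) * ENNReal.ofReal (infDist y Ωᶜ ^ (-(σ * p))) ≤
        C * gagliardo σ p v := by
  obtain ⟨C, hC, h⟩ := hΩ.exists_infDist_rpow_neg_le_lintegral_compl volume hΩo hΩb
    (mul_nonneg hσ hp.le)
  simp only [finrank_euclideanSpace_fin] at h
  refine ⟨C, hC, fun v hv hv0 => ?_⟩
  rw [gagliardo_eq_lintegral_lintegral hv, ← lintegral_const_mul' _ _ hC]
  refine (setLIntegral_mono' hΩo.measurableSet fun y hy => ?_).trans (setLIntegral_le_lintegral _ _)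
  calc ENNReal.ofReal (|v y| ^ p) * ENNReal.ofReal (infDist y Ωᶜ ^ (-(σ * p)))
      ≤ ENNReal.ofReal (|v y| ^ p) *
          (C * ∫⁻ z in Ωᶜ, ENNReal.ofReal (1 / ‖y - z‖ ^ ((N : ℝ) + σ * p))) := by
        gcongr
        exact h y hy
    _ = C * ∫⁻ z in Ωᶜ, ENNReal.ofReal (|v y - v z| ^ p / ‖y - z‖ ^ ((N : ℝ) + σ * p)) := by
        rw [mul_left_comm, ← lintegral_const_mul' _ _ ENNReal.ofReal_ne_top]
        congr 1
        refine setLIntegral_congr_fun_ae hΩo.measurableSet.compl ?_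
        filter_upwards [hv0] with z hz hzΩ
        rw [hz hzΩ, sub_zero, ← ENNReal.ofReal_mul (by positivity), mul_one_div]
    _ ≤ C * ∫⁻ z, ENNReal.ofReal (|v y - v z| ^ p / ‖y - z‖ ^ ((N : ℝ) + σ * p)) := by
        gcongr
        exact Measure.restrict_le_self

end HasExteriorCorkscrew

lemma abs_cutoffProfile_mul_sub_rpow_div_le {k b : ℝ} (hk : 0 ≤ k) (hp : 0 < p) (hb : 0 < b)
    {x y : RN N} (hy : 0 < infDist y Ωᶜ) :
    |cutoffProfile k (infDist x Ωᶜ) * v x - cutoffProfile k (infDist y Ωᶜ) * v y| ^ p /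
        ‖x - y‖ ^ b ≤
      2 ^ p * (|v x - v y| ^ p / ‖x - y‖ ^ b) + 8 ^ p * (|v y| ^ p *
        min (infDist y Ωᶜ ^ (-p) * ‖x - y‖ ^ (p - b)) (‖x - y‖ ^ (-b))) := by
  set η := fun x => cutoffProfile k (infDist x Ωᶜ)
  have hlip : |infDist x Ωᶜ - infDist y Ωᶜ| ≤ ‖x - y‖ := by
    simpa [Real.dist_eq, dist_eq_norm] using (lipschitz_infDist_pt Ωᶜ).dist_le_mul x y
  have hηsub : |η x - η y| ≤ min 1 (4 * ‖x - y‖ / infDist y Ωᶜ) :=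
    (abs_cutoffProfile_sub_le hk hy).trans (by gcongr)
  have hηx : |η x| ≤ 1 := by
    rw [abs_of_nonneg (cutoffProfile_nonneg _ _)]
    exact cutoffProfile_le_one _ _
  have hprod : |η x * v x - η y * v y| ≤ |v x - v y| + |η x - η y| * |v y| :=
    calc |η x * v x - η y * v y| = |η x * (v x - v y) + (η x - η y) * v y| := by ring_nf
      _ ≤ |η x| * |v x - v y| + |η x - η y| * |v y| := by
          simpa only [abs_mul] using abs_add_le (η x * (v x - v y)) ((η x - η y) * v y)
      _ ≤ |v x - v y| + |η x - η y| * |v y| := by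
          gcongr
          exact mul_le_of_le_one_left (abs_nonneg _) hηx
  calc |η x * v x - η y * v y| ^ p / ‖x - y‖ ^ b
      ≤ (|v x - v y| + |η x - η y| * |v y|) ^ p / ‖x - y‖ ^ b := by gcongr
    _ ≤ 2 ^ p * (|v x - v y| ^ p + (|η x - η y| * |v y|) ^ p) / ‖x - y‖ ^ b := by
        gcongr
        exact add_rpow_le_two_rpow_mul (by positivity) (by positivity) hp.le
    _ = 2 ^ p * (|v x - v y| ^ p / ‖x - y‖ ^ b) +
          2 ^ p * |v y| ^ p * (|η x - η y| ^ p / ‖x - y‖ ^ b) := by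
        rw [Real.mul_rpow (abs_nonneg _) (abs_nonneg _)]
        ring
    _ ≤ 2 ^ p * (|v x - v y| ^ p / ‖x - y‖ ^ b) + 2 ^ p * |v y| ^ p *
          (4 ^ p * min (infDist y Ωᶜ ^ (-p) * ‖x - y‖ ^ (p - b)) (‖x - y‖ ^ (-b))) := by
        gcongr
        exact (by gcongr : |η x - η y| ^ p / ‖x - y‖ ^ b ≤
          min 1 (4 * ‖x - y‖ / infDist y Ωᶜ) ^ p / ‖x - y‖ ^ b).trans
          (min_one_div_rpow_div_rpow_le hy (norm_nonneg _) hp.le hb)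
    _ = _ := by
        rw [show (8 : ℝ) = 2 * 4 by norm_num, Real.mul_rpow two_pos.le (by norm_num)]
        ring

lemma lintegral_rpow_mul_min_eq (hΩo : IsOpen Ω) (hΩb : Bornology.IsBounded Ω) [NeZero N]
    (hv : Measurable v) :
    ∫⁻ z : RN N × RN N, Ω.indicator (fun y => ENNReal.ofReal (|v y| ^ p)) z.2 *
        ENNReal.ofReal (min (infDist z.2 Ωᶜ ^ (-p) * ‖z.1 - z.2‖ ^ (p - ((N : ℝ) + σ * p)))
          (‖z.1 - z.2‖ ^ (-((N : ℝ) + σ * p)))) =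
      (∫⁻ y in Ω, ENNReal.ofReal (|v y| ^ p) * ENNReal.ofReal (infDist y Ωᶜ ^ (-(σ * p)))) *
        ∫⁻ h : RN N, ENNReal.ofReal (min (‖h‖ ^ (p - ((N : ℝ) + σ * p)))
          (‖h‖ ^ (-((N : ℝ) + σ * p)))) := by
  have hΩm : Measurable (Ω.indicator fun y => ENNReal.ofReal (|v y| ^ p)) :=
    (by fun_prop : Measurable fun y => ENNReal.ofReal (|v y| ^ p)).indicator hΩo.measurableSet
  have : Measurable fun x : RN N => infDist x Ωᶜ := measurable_infDist
  rw [Measure.volume_eq_prod, lintegral_prod_symm _ (by fun_prop),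
    ← lintegral_mul_const _ (by fun_prop), ← lintegral_indicator hΩo.measurableSet]
  refine lintegral_congr fun y => ?_
  by_cases hy : y ∈ Ω
  · simp only [indicator_of_mem hy]
    rw [lintegral_const_mul' _ _ ENNReal.ofReal_ne_top, mul_assoc]
    congr 1
    rw [lintegral_sub_right_eq_self (fun h => ENNReal.ofReal (min
        (infDist y Ωᶜ ^ (-p) * ‖h‖ ^ (p - ((N : ℝ) + σ * p))) (‖h‖ ^ (-((N : ℝ) + σ * p))))) y,
      lintegral_min_mul_norm_rpow_eq volume (infDist_compl_pos hΩo hΩb hy)]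
    congr 3
    rw [finrank_euclideanSpace_fin]
    ring
  · simp [hy]

lemma HasExteriorCorkscrew.exists_gagliardo_cutoffProfile_mul_le [NeZero N] (hΩo : IsOpen Ω)
    (hΩb : Bornology.IsBounded Ω) (hΩ : HasExteriorCorkscrew Ω) (hσ0 : 0 < σ) (hσ1 : σ < 1)
    (hp : 0 < p) :
    ∃ C : ℝ≥0∞, C ≠ ⊤ ∧ ∀ v : RN N → ℝ, Measurable v → (∀ᵐ x, x ∉ Ω → v x = 0) →
      ∀ k : ℝ, 0 ≤ k → gagliardo σ p (fun x => cutoffProfile k (infDist x Ωᶜ) * v x) ≤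
        C * gagliardo σ p v := by
  obtain ⟨C, hC, hHardy⟩ :=
    hΩ.exists_lintegral_rpow_mul_infDist_rpow_neg_le hΩo hΩb hσ0.le hp
  have hb : (N : ℝ) < N + σ * p := lt_add_of_pos_right _ (by positivity)
  have hker := lintegral_min_norm_rpow_neg_lt_top (E := RN N) volume (a := N + σ * p - p)
    (b := N + σ * p) (by rw [finrank_euclideanSpace_fin]; nlinarith)
    (by rwa [finrank_euclideanSpace_fin])
  simp only [neg_sub] at hker
  refine ⟨ENNReal.ofReal (2 ^ p) + ENNReal.ofReal (8 ^ p) * (C * _), ENNReal.add_ne_top.2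
    ⟨ENNReal.ofReal_ne_top, ENNReal.mul_ne_top ENNReal.ofReal_ne_top
      (ENNReal.mul_ne_top hC hker.ne)⟩, fun v hv hv0 k hk => ?_⟩
  rw [add_mul, mul_assoc, mul_right_comm]
  grw [← hHardy v hv hv0, ← lintegral_rpow_mul_min_eq hΩo hΩb hv]
  rw [gagliardo, gagliardo, ← lintegral_const_mul' _ _ ENNReal.ofReal_ne_top,
    ← lintegral_const_mul' _ _ ENNReal.ofReal_ne_top, ← lintegral_add_left (by fun_prop)]
  refine lintegral_mono_ae ?_
  filter_upwards [Measure.quasiMeasurePreserving_snd.ae hv0] with z hz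
  by_cases hzΩ : z.2 ∈ Ω
  · rw [indicator_of_mem hzΩ, ← ENNReal.ofReal_mul (p := |v z.2| ^ p) (by positivity),
      ← ENNReal.ofReal_mul (p := 2 ^ p) (by positivity),
      ← ENNReal.ofReal_mul (p := 8 ^ p) (by positivity),
      ← ENNReal.ofReal_add (by positivity) (by
        have := infDist_nonneg (x := z.2) (s := Ωᶜ)
        positivity)]
    exact ENNReal.ofReal_le_ofReal (abs_cutoffProfile_mul_sub_rpow_div_le hk hp
      ((Nat.cast_nonneg N).trans_lt hb) (infDist_compl_pos hΩo hΩb hzΩ))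
  · rw [indicator_of_notMem hzΩ, zero_mul, mul_zero, add_zero, hz hzΩ, mul_zero, sub_zero, sub_zero,
      ← ENNReal.ofReal_mul (by positivity), ← mul_div_assoc, abs_mul,
      abs_of_nonneg (cutoffProfile_nonneg _ _)]
    gcongr
    exact (Real.rpow_le_rpow (by have := cutoffProfile_nonneg k (infDist z.1 Ωᶜ); positivity)
      (mul_le_of_le_one_left (abs_nonneg _) (cutoffProfile_le_one _ _)) hp.le).trans
      (le_mul_of_one_le_left (by positivity) (Real.one_le_rpow one_le_two hp.le))

end FractionalHardy

section Mollification

open scoped Convolution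

lemma enorm_integral_rpow_le_lintegral {X F : Type*} [MeasurableSpace X] [NormedAddCommGroup F]
    [NormedSpace ℝ F] {ν : Measure X} [IsProbabilityMeasure ν] {f : X → F} {p : ℝ} (hp : 1 ≤ p)
    (hf : AEStronglyMeasurable f ν) : ‖∫ x, f x ∂ν‖ₑ ^ p ≤ ∫⁻ x, ‖f x‖ₑ ^ p ∂ν := by
  have hp0 : 0 < p := one_pos.trans_le hp
  have h := eLpNorm'_le_eLpNorm'_of_exponent_le one_pos hp ν hf
  simp only [eLpNorm', ENNReal.rpow_one, div_one] at h
  calc ‖∫ x, f x ∂ν‖ₑ ^ p ≤ ((∫⁻ x, ‖f x‖ₑ ^ p ∂ν) ^ (1 / p)) ^ p := by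
        gcongr
        exact (enorm_integral_le_lintegral_enorm f).trans h
    _ = ∫⁻ x, ‖f x‖ₑ ^ p ∂ν := by
        rw [← ENNReal.rpow_mul, one_div_mul_cancel hp0.ne', ENNReal.rpow_one]

lemma convolution_lsmul_eq_integral_withDensity {G : Type*} [MeasurableSpace G] [AddGroup G]
    {μ : Measure G} {ρ φ : G → ℝ} (hρ : Measurable ρ) (hρ0 : ∀ x, 0 ≤ ρ x) (x : G) :
    (ρ ⋆[ContinuousLinearMap.lsmul ℝ ℝ, μ] φ) x =
      ∫ h, φ (x - h) ∂μ.withDensity fun h => ENNReal.ofReal (ρ h) := by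
  rw [integral_withDensity_eq_integral_toReal_smul (by fun_prop) (by simp), convolution_def]
  simp [ENNReal.toReal_ofReal (hρ0 _)]

lemma isProbabilityMeasure_withDensity_ofReal {X : Type*} [MeasurableSpace X] {μ : Measure X}
    {ρ : X → ℝ} (hρ : Integrable ρ μ) (hρ0 : ∀ x, 0 ≤ ρ x) (hρ1 : ∫ x, ρ x ∂μ = 1) :
    IsProbabilityMeasure (μ.withDensity fun x => ENNReal.ofReal (ρ x)) := by
  refine ⟨?_⟩
  rw [withDensity_apply _ .univ, Measure.restrict_univ,
    ← ofReal_integral_eq_lintegral_ofReal hρ (Eventually.of_forall hρ0), hρ1, ENNReal.ofReal_one]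

variable {N : ℕ} {σ p : ℝ} {φ : RN N → ℝ}

lemma gagliardo_eq_lintegral_enorm (hp : 0 ≤ p) :
    gagliardo σ p φ = ∫⁻ z : RN N × RN N,
      ‖φ z.1 - φ z.2‖ₑ ^ p * ENNReal.ofReal ((‖z.1 - z.2‖ ^ ((N : ℝ) + σ * p))⁻¹) := by
  refine lintegral_congr fun z => ?_
  rw [div_eq_mul_inv, ENNReal.ofReal_mul (by positivity), Real.enorm_eq_ofReal_abs,
    ENNReal.ofReal_rpow_of_nonneg (abs_nonneg _) hp]

lemma gagliardo_comp_sub_right (h : RN N) :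
    gagliardo σ p (fun x => φ (x - h)) = gagliardo σ p φ := by
  have : (volume : Measure (RN N × RN N)).IsAddRightInvariant :=
    inferInstanceAs ((volume : Measure (RN N)).prod volume).IsAddRightInvariant
  simpa [gagliardo] using lintegral_sub_right_eq_self (μ := (volume : Measure (RN N × RN N)))
    (fun z => ENNReal.ofReal (|φ z.1 - φ z.2| ^ p / ‖z.1 - z.2‖ ^ ((N : ℝ) + σ * p))) (h, h)

lemma gagliardo_integral_comp_sub_le {ν : Measure (RN N)} [IsProbabilityMeasure ν] (hp : 1 ≤ p)
    (hφ : Measurable φ) (hint : ∀ x, Integrable (fun h => φ (x - h)) ν) :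
    gagliardo σ p (fun x => ∫ h, φ (x - h) ∂ν) ≤ gagliardo σ p φ := by
  have hp0 : 0 ≤ p := zero_le_one.trans hp
  set w : RN N × RN N → ℝ≥0∞ :=
    fun z => ENNReal.ofReal ((‖z.1 - z.2‖ ^ ((N : ℝ) + σ * p))⁻¹) with hw
  have hwm : Measurable w := by fun_prop
  calc gagliardo σ p (fun x => ∫ h, φ (x - h) ∂ν)
      = ∫⁻ z : RN N × RN N, ‖∫ h, (φ (z.1 - h) - φ (z.2 - h)) ∂ν‖ₑ ^ p * w z := by
        simp only [gagliardo_eq_lintegral_enorm hp0, integral_sub (hint _) (hint _), hw]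
    _ ≤ ∫⁻ z : RN N × RN N, ∫⁻ h, ‖φ (z.1 - h) - φ (z.2 - h)‖ₑ ^ p * w z ∂ν := by
        refine lintegral_mono fun z => ?_
        rw [lintegral_mul_const _ (by fun_prop)]
        gcongr
        exact enorm_integral_rpow_le_lintegral hp (by fun_prop)
    _ = ∫⁻ h, (∫⁻ z : RN N × RN N, ‖φ (z.1 - h) - φ (z.2 - h)‖ₑ ^ p * w z) ∂ν :=
        lintegral_lintegral_swap (by simp only [Function.uncurry_def]; fun_prop)
    _ = ∫⁻ h, gagliardo σ p (fun x => φ (x - h)) ∂ν := by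
        simp only [gagliardo_eq_lintegral_enorm hp0, hw]
    _ = gagliardo σ p φ := by
        simp only [gagliardo_comp_sub_right, lintegral_const, measure_univ, mul_one]

lemma tsupport_convolution_subset_cthickening {E : Type*} [NormedAddCommGroup E]
    [MeasurableSpace E] {μ : Measure E} {ρ φ : E → ℝ} {K : Set E} {δ : ℝ}
    (hρ : Function.support ρ ⊆ ball 0 δ) (hφ : ∀ x ∉ K, φ x = 0) :
    tsupport (ρ ⋆[ContinuousLinearMap.lsmul ℝ ℝ, μ] φ) ⊆ cthickening δ K := by
  refine closure_minimal ((support_convolution_subset _).trans ?_) isClosed_cthickening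
  rintro _ ⟨a, ha, c, hc, rfl⟩
  refine mem_cthickening_of_dist_le _ c δ K (not_imp_comm.1 (hφ c) hc) ?_
  simpa [dist_eq_norm] using (mem_ball_zero_iff.1 (hρ ha)).le

lemma exists_seq_isTestFunction_tendsto {Ω K : Set (RN N)} {M : ℝ} (hΩ : IsOpen Ω)
    (hK : IsCompact K) (hKΩ : K ⊆ Ω) (hp : 1 ≤ p) (hφ : Measurable φ) (hM : ∀ x, |φ x| ≤ M)
    (hφK : ∀ x ∉ K, φ x = 0) :
    ∃ ψ : ℕ → RN N → ℝ, (∀ j, IsTestFunction Ω (ψ j)) ∧ (∀ j x, |ψ j x| ≤ M) ∧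
      (∀ j, gagliardo σ p (ψ j) ≤ gagliardo σ p φ) ∧
      ∀ᵐ x, Tendsto (fun j => ψ j x) atTop (𝓝 (φ x)) := by
  obtain ⟨δ, hδ, hδΩ⟩ := hK.exists_cthickening_subset_open hΩ hKΩ
  let B : ℕ → ContDiffBump (0 : RN N) := fun j =>
    ⟨δ / (j + 1) / 2, δ / (j + 1), by positivity, half_lt_self (by positivity)⟩
  have hB (j : ℕ) : (B j).rOut ≤ δ := div_le_self hδ.le (by linarith [Nat.cast_nonneg (α := ℝ) j])
  have hφi : LocallyIntegrable φ := (locallyIntegrable_const M).mono hφ.aestronglyMeasurable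
    (Eventually.of_forall fun x => (hM x).trans (le_abs_self M))
  have hconv (j : ℕ) := convolution_lsmul_eq_integral_withDensity (μ := volume) (φ := φ)
    (ρ := (B j).normed volume) (B j).continuous_normed.measurable (B j).nonneg_normed
  have hprob (j : ℕ) := isProbabilityMeasure_withDensity_ofReal (μ := volume)
    (ρ := (B j).normed volume) (B j).integrable_normed (B j).nonneg_normed (B j).integral_normed
  refine ⟨fun j => (B j).normed volume ⋆[ContinuousLinearMap.lsmul ℝ ℝ, volume] φ,
    fun j => ?_, fun j x => ?_, fun j => ?_, ?_⟩
  · have hsub := tsupport_convolution_subset_cthickening (μ := volume)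
      (((B j).support_normed_eq (μ := volume)).subset.trans (ball_subset_ball (hB j))) hφK
    exact ⟨(B j).hasCompactSupport_normed.contDiff_convolution_left _ (B j).contDiff_normed hφi,
      hK.cthickening.of_isClosed_subset (isClosed_tsupport _) hsub, hsub.trans hδΩ⟩
  · beta_reduce
    rw [hconv]
    have hMx (h : RN N) : ‖φ (x - h)‖ ≤ M := hM (x - h)
    simpa using norm_integral_le_of_norm_le_const (μ := volume.withDensity fun h =>
      ENNReal.ofReal ((B j).normed volume h)) (Eventually.of_forall hMx)
  · simp only [funext (hconv j)]
    exact gagliardo_integral_comp_sub_le hp hφ fun x =>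
      .of_bound (hφ.comp (measurable_const.sub measurable_id)).aestronglyMeasurable M
        (Eventually.of_forall fun h => hM (x - h))
  · refine ContDiffBump.ae_convolution_tendsto_right_of_locallyIntegrable (K := 2) ?_ ?_ hφi
    · simpa [B, div_eq_mul_inv] using
        (tendsto_one_div_add_atTop_nhds_zero_nat (𝕜 := ℝ)).const_mul δ
    · exact Eventually.of_forall fun j => (mul_div_cancel₀ _ two_ne_zero).ge

end Mollification

section DifferenceQuotient

variable {N : ℕ} {σ p : ℝ} {u : RN N → ℝ}

/-- The function on `ℝ^{2N}` whose `L^p` norm is the norm of `W_0^{σ,p}`. -/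
noncomputable def diffQuotient (σ p : ℝ) (u : RN N → ℝ) (z : RN N × RN N) : ℝ :=
  (u z.1 - u z.2) / ‖z.1 - z.2‖ ^ ((N : ℝ) / p + σ)

lemma aestronglyMeasurable_diffQuotient (hu : AEStronglyMeasurable u volume) :
    AEStronglyMeasurable (diffQuotient σ p u) volume := by
  have h₁ : AEStronglyMeasurable (fun z : RN N × RN N => u z.1) volume :=
    hu.comp_quasiMeasurePreserving Measure.quasiMeasurePreserving_fst
  have h₂ : AEStronglyMeasurable (fun z : RN N × RN N => u z.2) volume :=
    hu.comp_quasiMeasurePreserving Measure.quasiMeasurePreserving_snd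
  have hk : Measurable fun z : RN N × RN N => ‖z.1 - z.2‖ ^ ((N : ℝ) / p + σ) := by fun_prop
  exact ((h₁.sub h₂).aemeasurable.div hk.aemeasurable).aestronglyMeasurable

lemma eLpNorm_diffQuotient (hp : 0 < p) :
    eLpNorm (diffQuotient σ p u) (ENNReal.ofReal p) volume = normW0 σ p u := by
  rw [eLpNorm_eq_lintegral_rpow_enorm_toReal (by simpa) ENNReal.ofReal_ne_top,
    ENNReal.toReal_ofReal hp.le, normW0, gagliardo]
  congr 1
  refine lintegral_congr fun z => ?_
  rw [Real.enorm_eq_ofReal_abs, ENNReal.ofReal_rpow_of_nonneg (abs_nonneg _) hp.le, diffQuotient,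
    abs_div, abs_of_nonneg (a := ‖_‖ ^ _) (by positivity),
    Real.div_rpow (abs_nonneg _) (by positivity), ← Real.rpow_mul (norm_nonneg _), add_mul,
    div_mul_cancel₀ _ hp.ne']

lemma normW0_ne_top (hp : 0 < p) (h : gagliardo σ p u ≠ ⊤) : normW0 σ p u ≠ ⊤ :=
  ENNReal.rpow_ne_top_of_nonneg (by positivity) h

lemma memLp_diffQuotient (hp : 0 < p) (hu : AEStronglyMeasurable u volume)
    (h : gagliardo σ p u ≠ ⊤) : MemLp (diffQuotient σ p u) (ENNReal.ofReal p) volume :=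
  ⟨aestronglyMeasurable_diffQuotient hu,
    (eLpNorm_diffQuotient hp).trans_lt (normW0_ne_top hp h).lt_top⟩

lemma gagliardo_congr_ae {v : RN N → ℝ} (h : u =ᵐ[volume] v) :
    gagliardo σ p u = gagliardo σ p v := by
  refine lintegral_congr_ae ?_
  filter_upwards [Measure.quasiMeasurePreserving_fst.ae_eq_comp h,
    Measure.quasiMeasurePreserving_snd.ae_eq_comp h] with z h₁ h₂
  simp only [Function.comp_apply] at h₁ h₂
  rw [h₁, h₂]

lemma fracForm_eq_integral_diffQuotient {s : ℝ} (hs : 0 ≤ s) (u φ : RN N → ℝ) :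
    fracForm s u φ = ∫ z, diffQuotient s 2 u z * diffQuotient s 2 φ z := by
  refine integral_congr_ae (Eventually.of_forall fun z => ?_)
  beta_reduce
  rw [diffQuotient, diffQuotient, div_mul_div_comm,
    ← Real.rpow_add_of_nonneg (norm_nonneg _) (by positivity) (by positivity)]
  ring_nf

lemma tendsto_fracForm {s : ℝ} (hs : 0 ≤ s) (hu : AEStronglyMeasurable u volume)
    (hug : gagliardo s 2 u ≠ ⊤) {φ : ℕ → RN N → ℝ} {φ₀ : RN N → ℝ} {C : ℝ≥0∞} (hC : C ≠ ⊤)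
    (hφ : ∀ k, AEStronglyMeasurable (φ k) volume) (hφC : ∀ k, gagliardo s 2 (φ k) ≤ C)
    (hlim : ∀ᵐ x, Tendsto (fun k => φ k x) atTop (𝓝 (φ₀ x))) :
    Tendsto (fun k => fracForm s u (φ k)) atTop (𝓝 (fracForm s u φ₀)) := by
  have hu₂ := memLp_diffQuotient two_pos hu hug
  rw [ENNReal.ofReal_ofNat] at hu₂
  simp only [fracForm_eq_integral_diffQuotient hs]
  refine tendsto_integral_mul_of_ae_tendsto (q := 2) (C := C ^ (1 / 2 : ℝ)) (by simp) hu₂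
    (ENNReal.rpow_ne_top_of_nonneg (by norm_num) hC)
    (fun k => aestronglyMeasurable_diffQuotient (hφ k)) (fun k => ?_) ?_
  · have h := eLpNorm_diffQuotient (σ := s) (u := φ k) two_pos
    rw [ENNReal.ofReal_ofNat] at h
    rw [h, normW0]
    gcongr
    exact hφC k
  · filter_upwards [Measure.quasiMeasurePreserving_fst.ae hlim,
      Measure.quasiMeasurePreserving_snd.ae hlim] with z h₁ h₂
    exact (h₁.sub h₂).div_const _

end DifferenceQuotient

section Potentials

lemma rpow_le_one_add_rpow {x q r : ℝ} (hx : 0 ≤ x) (hq : 0 ≤ q) (hqr : q ≤ r) :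
    x ^ q ≤ 1 + x ^ r := by
  rcases le_total x 1 with h | h
  · linarith [Real.rpow_le_one hx h hq, Real.rpow_nonneg hx r]
  · linarith [Real.rpow_le_rpow_of_exponent_le h hqr]

lemma rpow_le_one_add_rpow_rpow {x q r a : ℝ} (hx : 0 ≤ x) (hr : 0 < r) (hq : 0 ≤ q)
    (ha : q / r ≤ a) : x ^ q ≤ (1 + x ^ r) ^ a :=
  calc x ^ q = (x ^ r) ^ (q / r) := by rw [← Real.rpow_mul hx, mul_div_cancel₀ _ hr.ne']
    _ ≤ (1 + x ^ r) ^ (q / r) := by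
        gcongr
        exact le_add_of_nonneg_left zero_le_one
    _ ≤ (1 + x ^ r) ^ a :=
        Real.rpow_le_rpow_of_exponent_le (le_add_of_nonneg_right (by positivity)) ha

lemma rpow_mul_rpow_mul_rpow_le {X Y k a c : ℝ} (hX : 0 ≤ X) (hY : 0 ≤ Y) (hk : 0 ≤ k)
    (ha : a ≤ 1) (hc : c ≤ 1) (hac : 1 ≤ a + c) :
    Y ^ a * X ^ c * k ^ (2 - a - c) ≤ X * Y + Y * k + X * k := by
  have h := Real.geom_mean_le_arith_mean3_weighted (w₁ := a + c - 1) (w₂ := 1 - c) (w₃ := 1 - a)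
    (p₁ := X * Y) (p₂ := Y * k) (p₃ := X * k) (by linarith) (by linarith) (by linarith)
    (by positivity) (by positivity) (by positivity) (by ring)
  rw [Real.mul_rpow hX hY, Real.mul_rpow hY hk, Real.mul_rpow hX hk] at h
  calc Y ^ a * X ^ c * k ^ (2 - a - c)
      = X ^ (a + c - 1) * Y ^ (a + c - 1) * (Y ^ (1 - c) * k ^ (1 - c)) *
          (X ^ (1 - a) * k ^ (1 - a)) := by
        rw [show Y ^ a = Y ^ (a + c - 1 + (1 - c)) by ring_nf,
          show X ^ c = X ^ (a + c - 1 + (1 - a)) by ring_nf,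
          show k ^ (2 - a - c) = k ^ (1 - c + (1 - a)) by ring_nf,
          Real.rpow_add_of_nonneg hY (by linarith) (by linarith),
          Real.rpow_add_of_nonneg hX (by linarith) (by linarith),
          Real.rpow_add_of_nonneg hk (by linarith) (by linarith)]
        ring
    _ ≤ (a + c - 1) * (X * Y) + (1 - c) * (Y * k) + (1 - a) * (X * k) := h
    _ ≤ X * Y + Y * k + X * k := by
        refine add_le_add (add_le_add ?_ ?_) ?_ <;>
          exact mul_le_of_le_one_left (by positivity) (by linarith)

lemma rpow_mul_rpow_div_rpow_le {x y h q q' r b a c : ℝ} (hx : 0 ≤ x) (hy : 0 ≤ y) (hh : 0 ≤ h)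
    (hr : 0 < r) (hq : 0 ≤ q) (hq' : 0 ≤ q') (hqa : q / r ≤ a) (hqc : q' / r ≤ c) (ha : a ≤ 1)
    (hc : c ≤ 1) (hac : 1 ≤ a + c) (hθ : 0 < 2 - a - c) :
    y ^ q * x ^ q' / h ^ b ≤ (1 + x ^ r) * (1 + y ^ r) +
      (1 + y ^ r) * h ^ (-(b / (2 - a - c))) + (1 + x ^ r) * h ^ (-(b / (2 - a - c))) :=
  calc y ^ q * x ^ q' / h ^ b
      = y ^ q * x ^ q' * (h ^ (-(b / (2 - a - c)))) ^ (2 - a - c) := by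
        rw [← Real.rpow_mul hh, neg_mul, div_mul_cancel₀ _ hθ.ne', Real.rpow_neg hh, div_eq_mul_inv]
    _ ≤ (1 + y ^ r) ^ a * (1 + x ^ r) ^ c * (h ^ (-(b / (2 - a - c)))) ^ (2 - a - c) := by
        gcongr
        · exact rpow_le_one_add_rpow_rpow hy hr hq hqa
        · exact rpow_le_one_add_rpow_rpow hx hr hq' hqc
    _ ≤ _ := rpow_mul_rpow_mul_rpow_le (by positivity) (by positivity) (by positivity) ha hc hac

variable {E : Type*} [NormedAddCommGroup E] [NormedSpace ℝ E] [FiniteDimensional ℝ E]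
  [MeasurableSpace E] [BorelSpace E] (μ : Measure E) [μ.IsAddHaarMeasure]

lemma lintegral_prod_mul_add_mul_sub_add_mul_sub {f k : E → ℝ≥0∞} (hf : AEMeasurable f μ)
    (hk : Measurable k) :
    ∫⁻ z, (f z.1 * f z.2 + f z.2 * k (z.1 - z.2) + f z.1 * k (z.1 - z.2)) ∂μ.prod μ =
      (∫⁻ x, f x ∂μ) * (∫⁻ x, f x ∂μ + 2 * ∫⁻ x, k x ∂μ) := by
  have : AEMeasurable (fun z : E × E => f z.1) (μ.prod μ) :=
    hf.comp_quasiMeasurePreserving Measure.quasiMeasurePreserving_fst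
  have : AEMeasurable (fun z : E × E => f z.2) (μ.prod μ) :=
    hf.comp_quasiMeasurePreserving Measure.quasiMeasurePreserving_snd
  rw [lintegral_add_right' _ (by fun_prop), lintegral_add_left' (by fun_prop),
    lintegral_prod_mul hf hf, lintegral_prod_fst_mul_sub hf hk,
    lintegral_prod_snd_mul_sub hf hk]
  ring

variable [Nontrivial E] {Ω : Set E} {r : ℝ}

lemma exists_lintegral_abs_div_norm_rpow_le (hΩb : Bornology.IsBounded Ω) {r' τ : ℝ}
    (hr : r.HolderConjugate r') (hτ : τ * r' < Module.finrank ℝ E) :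
    ∃ C : ℝ≥0∞, C ≠ ⊤ ∧ ∀ u : E → ℝ, ∫⁻ x in Ω, ENNReal.ofReal (|u x| / ‖x‖ ^ τ) ∂μ ≤
      ∫⁻ x in Ω, ENNReal.ofReal (|u x| ^ r) ∂μ + C := by
  obtain ⟨R, hR⟩ := hΩb.subset_ball (0 : E)
  refine ⟨_, (lintegral_ball_norm_rpow_neg_lt_top μ hτ R).ne, fun u => ?_⟩
  grw [← lintegral_mono_set (μ := μ) hR, ← lintegral_add_right _ (by fun_prop)]
  refine lintegral_mono fun x => ?_
  rw [← ENNReal.ofReal_add (by positivity) (by positivity)]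
  refine ENNReal.ofReal_le_ofReal ?_
  calc |u x| / ‖x‖ ^ τ = |u x| * ‖x‖ ^ (-τ) := by
        rw [Real.rpow_neg (norm_nonneg _), div_eq_mul_inv]
    _ ≤ |u x| ^ r / r + (‖x‖ ^ (-τ)) ^ r' / r' :=
        Real.young_inequality_of_nonneg (abs_nonneg _) (by positivity) hr
    _ ≤ |u x| ^ r + (‖x‖ ^ (-τ)) ^ r' :=
        add_le_add (div_le_self (by positivity) hr.lt.le)
          (div_le_self (by positivity) hr.symm.lt.le)
    _ = |u x| ^ r + ‖x‖ ^ (-(τ * r')) := by rw [← Real.rpow_mul (norm_nonneg _), neg_mul]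

lemma exists_lintegral_rpow_mul_rpow_div_norm_sub_rpow_le_of_weights (hΩ : MeasurableSet Ω)
    (hΩb : Bornology.IsBounded Ω) {q q' b a c : ℝ} (hr : 0 < r) (hq : 0 ≤ q) (hq' : 0 ≤ q')
    (hqa : q / r ≤ a) (hqc : q' / r ≤ c) (ha : a ≤ 1) (hc : c ≤ 1) (hac : 1 ≤ a + c)
    (hθ : 0 < 2 - a - c) (hb : b / (2 - a - c) < Module.finrank ℝ E) :
    ∃ C : ℝ≥0∞, C ≠ ⊤ ∧ ∀ u : E → ℝ, AEMeasurable u μ →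
      ∫⁻ z in Ω ×ˢ Ω, ENNReal.ofReal (|u z.2| ^ q * |u z.1| ^ q' / ‖z.1 - z.2‖ ^ b) ∂μ.prod μ ≤
        (∫⁻ x in Ω, ENNReal.ofReal (1 + |u x| ^ r) ∂μ) *
          (∫⁻ x in Ω, ENNReal.ofReal (1 + |u x| ^ r) ∂μ + C) := by
  obtain ⟨R, hR⟩ := hΩb.subset_ball (0 : E)
  set k : E → ℝ≥0∞ := (ball 0 (2 * R)).indicator
    fun h => ENNReal.ofReal (‖h‖ ^ (-(b / (2 - a - c)))) with hk
  have hkm : Measurable k := Measurable.indicator (by fun_prop) measurableSet_ball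
  have hkC : ∫⁻ h, k h ∂μ ≠ ⊤ := by
    rw [lintegral_indicator measurableSet_ball]
    exact (lintegral_ball_norm_rpow_neg_lt_top μ hb (2 * R)).ne
  refine ⟨2 * ∫⁻ h, k h ∂μ, ENNReal.mul_ne_top (by simp) hkC, fun u hu => ?_⟩
  set f : E → ℝ≥0∞ := Ω.indicator fun x => ENNReal.ofReal (1 + |u x| ^ r) with hf
  have hfm : AEMeasurable f μ := AEMeasurable.indicator (by fun_prop) hΩ
  rw [← lintegral_indicator hΩ, ← lintegral_prod_mul_add_mul_sub_add_mul_sub μ hfm hkm]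
  refine (setLIntegral_mono' (hΩ.prod hΩ) fun z hz => ?_).trans (setLIntegral_le_lintegral _ _)
  have hzR : z.1 - z.2 ∈ ball (0 : E) (2 * R) := by
    have h₁ := mem_ball_zero_iff.1 (hR hz.1)
    have h₂ := mem_ball_zero_iff.1 (hR hz.2)
    rw [mem_ball_zero_iff]
    linarith [norm_sub_le z.1 z.2]
  simp only [hf, hk, indicator_of_mem hz.1, indicator_of_mem hz.2, indicator_of_mem hzR]
  rw [← ENNReal.ofReal_mul (by positivity), ← ENNReal.ofReal_mul (by positivity),
    ← ENNReal.ofReal_mul (by positivity), ← ENNReal.ofReal_add (by positivity) (by positivity),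
    ← ENNReal.ofReal_add (by positivity) (by positivity)]
  exact ENNReal.ofReal_le_ofReal (rpow_mul_rpow_div_rpow_le (abs_nonneg _) (abs_nonneg _)
    (norm_nonneg _) hr hq hq' hqa hqc ha hc hac hθ)

lemma exists_lintegral_rpow_mul_rpow_div_norm_sub_rpow_le (hΩ : MeasurableSet Ω)
    (hΩb : Bornology.IsBounded Ω) {q q' b : ℝ} (hq : 0 ≤ q) (hq' : 0 ≤ q') (hr : 0 < r)
    (hqr : q ≤ r) (hqr' : q' ≤ r) (hb0 : 0 ≤ b) (hb : b < Module.finrank ℝ E)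
    (hqb : q / r + q' / r + b / Module.finrank ℝ E < 2) :
    ∃ C : ℝ≥0∞, C ≠ ⊤ ∧ ∀ u : E → ℝ, AEMeasurable u μ →
      ∫⁻ z in Ω ×ˢ Ω, ENNReal.ofReal (|u z.2| ^ q * |u z.1| ^ q' / ‖z.1 - z.2‖ ^ b) ∂μ.prod μ ≤
        (∫⁻ x in Ω, ENNReal.ofReal (1 + |u x| ^ r) ∂μ) *
          (∫⁻ x in Ω, ENNReal.ofReal (1 + |u x| ^ r) ∂μ + C) := by
  have hn : (0 : ℝ) < Module.finrank ℝ E := hb0.trans_lt hb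
  have hbc : b / Module.finrank ℝ E < 2 - q / r - max (q' / r) (1 - q / r) := by
    rcases max_choice (q' / r) (1 - q / r) with h | h <;> rw [h]
    · linarith
    · linarith [(div_lt_one hn).2 hb]
  have hθ := (div_nonneg hb0 hn.le).trans_lt hbc
  refine exists_lintegral_rpow_mul_rpow_div_norm_sub_rpow_le_of_weights μ hΩ hΩb hr hq hq'
    le_rfl (le_max_left _ _) ((div_le_one hr).2 hqr)
    (max_le ((div_le_one hr).2 hqr') (by linarith [div_nonneg hq hr.le]))
    (by linarith [le_max_right (q' / r) (1 - q / r)]) hθ ?_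
  rwa [div_lt_iff₀ hθ, ← div_lt_iff₀' hn]

end Potentials

section TestFunctions

variable {N : ℕ} {Ω : Set (RN N)} {κ s M : ℝ} {f u v : RN N → ℝ}

/-- `κ (-Δ)^s u = f` in `Ω` in the sense of distributions, where `(-Δ)^s` is the operator of the
form `fracForm s`. -/
def IsDistributionalSolution (Ω : Set (RN N)) (κ s : ℝ) (f u : RN N → ℝ) : Prop :=
  ∀ φ, IsTestFunction Ω φ → κ * fracForm s u φ = ∫ x in Ω, f x * φ x

lemma mul_fracForm_eq_integral_mul_of_tendsto (hs : 0 ≤ s) (hu : AEStronglyMeasurable u volume)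
    (hug : gagliardo s 2 u ≠ ⊤) (hf : IntegrableOn f Ω) {φ : ℕ → RN N → ℝ} {C : ℝ≥0∞}
    (hC : C ≠ ⊤) (hφ : ∀ k, AEStronglyMeasurable (φ k) volume) (hφM : ∀ k x, |φ k x| ≤ M)
    (hφC : ∀ k, gagliardo s 2 (φ k) ≤ C) (hlim : ∀ᵐ x, Tendsto (φ · x) atTop (𝓝 (v x)))
    (h : ∀ k, κ * fracForm s u (φ k) = ∫ x in Ω, f x * φ k x) :
    κ * fracForm s u v = ∫ x in Ω, f x * v x := by
  have h_rhs : Tendsto (fun k => ∫ x in Ω, f x * φ k x) atTop (𝓝 (∫ x in Ω, f x * v x)) :=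
    tendsto_integral_mul_of_ae_tendsto (p := 1) (q := ⊤) ENNReal.one_ne_top
      (memLp_one_iff_integrable.2 hf) ENNReal.ofReal_ne_top (fun k => (hφ k).restrict)
      (fun k => by
        simpa using eLpNorm_le_of_ae_bound (p := ⊤) (μ := volume.restrict Ω)
          (Eventually.of_forall (hφM k)))
      (ae_restrict_of_ae hlim)
  refine tendsto_nhds_unique ?_ h_rhs
  simpa only [h] using (tendsto_fracForm hs hu hug hC hφ hφC hlim).const_mul κ

lemma isCompact_setOf_one_le_mul_infDist_compl (hΩb : Bornology.IsBounded Ω) (k : ℝ) :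
    IsCompact {x | 1 ≤ k * infDist x Ωᶜ} ∧ {x | 1 ≤ k * infDist x Ωᶜ} ⊆ Ω := by
  have hsub : {x | 1 ≤ k * infDist x Ωᶜ} ⊆ Ω := by
    intro x (hx : 1 ≤ k * infDist x Ωᶜ)
    by_contra hxΩ
    rw [infDist_zero_of_mem (s := Ωᶜ) hxΩ] at hx
    linarith
  exact ⟨isCompact_of_isClosed_isBounded
    (isClosed_le continuous_const (continuous_const.mul (continuous_infDist_pt _)))
    (hΩb.subset hsub), hsub⟩

variable [NeZero N]

lemma tendsto_cutoffProfile_infDist_mul (hΩo : IsOpen Ω) (hΩb : Bornology.IsBounded Ω) {x : RN N}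
    (hv : x ∉ Ω → v x = 0) :
    Tendsto (fun k : ℕ => cutoffProfile (k + 1) (infDist x Ωᶜ) * v x) atTop (𝓝 (v x)) := by
  by_cases hx : x ∈ Ω
  · have hd := infDist_compl_pos hΩo hΩb hx
    refine tendsto_const_nhds.congr' ?_
    filter_upwards [eventually_ge_atTop ⌈2 / infDist x Ωᶜ⌉₊] with k hk
    rw [cutoffProfile_of_two_le_mul, one_mul]
    rw [← div_le_iff₀ hd]
    linarith [Nat.ceil_le.1 hk]
  · simp only [hv hx, mul_zero, tendsto_const_nhds]

/- First cut `v` off near the boundary, where the fractional Hardy inequality keeps the energy of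
the cut-off functions bounded, and then mollify. -/
lemma IsDistributionalSolution.mul_fracForm_eq (h : IsDistributionalSolution Ω κ s f u)
    (hΩo : IsOpen Ω) (hΩb : Bornology.IsBounded Ω) (hΩ : HasExteriorCorkscrew Ω) (hs0 : 0 < s)
    (hs1 : s < 1) (hf : IntegrableOn f Ω) (hu : AEStronglyMeasurable u volume)
    (hug : gagliardo s 2 u ≠ ⊤) (hv : Measurable v) (hvM : ∀ x, |v x| ≤ M)
    (hvg : gagliardo s 2 v ≠ ⊤) (hv0 : ∀ᵐ x, x ∉ Ω → v x = 0) :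
    κ * fracForm s u v = ∫ x in Ω, f x * v x := by
  obtain ⟨C, hC, hvC⟩ := hΩ.exists_gagliardo_cutoffProfile_mul_le hΩo hΩb hs0 hs1 two_pos
  set φ : ℕ → RN N → ℝ := fun k x => cutoffProfile (k + 1) (infDist x Ωᶜ) * v x
  have hφm : ∀ k, Measurable (φ k) := fun k =>
    ((continuous_cutoffProfile _).comp (continuous_infDist_pt _)).measurable.mul hv
  have hφM : ∀ k x, |φ k x| ≤ M := fun k x => by
    rw [abs_mul, abs_of_nonneg (cutoffProfile_nonneg _ _)]
    exact (mul_le_of_le_one_left (abs_nonneg _) (cutoffProfile_le_one _ _)).trans (hvM x)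
  have hφC : ∀ k, gagliardo s 2 (φ k) ≤ C * gagliardo s 2 v := fun k =>
    hvC v hv hv0 _ (by positivity)
  have hC' : C * gagliardo s 2 v ≠ ⊤ := ENNReal.mul_ne_top hC hvg
  refine mul_fracForm_eq_integral_mul_of_tendsto hs0.le hu hug hf hC'
    (fun k => (hφm k).aestronglyMeasurable) hφM hφC
    (hv0.mono fun x => tendsto_cutoffProfile_infDist_mul hΩo hΩb) fun k => ?_
  obtain ⟨hK, hKΩ⟩ := isCompact_setOf_one_le_mul_infDist_compl hΩb (k + 1)
  obtain ⟨ψ, hψ, hψM, hψC, hψlim⟩ := exists_seq_isTestFunction_tendsto (σ := s) hΩo hK hKΩ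
    one_le_two (hφm k) (hφM k) fun x hx => by
      simp only [φ, cutoffProfile_of_mul_le_one (not_le.1 hx).le, zero_mul]
  exact mul_fracForm_eq_integral_mul_of_tendsto hs0.le hu hug hf
    ((hφC k).trans_lt hC'.lt_top).ne (fun j => (hψ j).contDiff.continuous.aestronglyMeasurable)
    hψM hψC hψlim fun j => h _ (hψ j)

end TestFunctions

section EnergyEstimate

/-- The bounded strictly increasing function `t ↦ t / (1 + |t|)`; composed with a solution it gives
the test function of the energy estimate for `L¹` data. -/
noncomputable def saturate (t : ℝ) : ℝ := t / (1 + |t|)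

@[fun_prop]
lemma measurable_saturate : Measurable saturate := by unfold saturate; fun_prop

lemma abs_saturate (t : ℝ) : |saturate t| = |t| / (1 + |t|) := by
  rw [saturate, abs_div, abs_of_nonneg (a := 1 + |t|) (by positivity)]

lemma abs_saturate_le_one (t : ℝ) : |saturate t| ≤ 1 := by
  rw [abs_saturate]
  exact div_le_one_of_le₀ (by linarith) (by positivity)

lemma saturate_sub_saturate (a b : ℝ) :
    saturate a - saturate b = (a - b + (a * |b| - b * |a|)) / ((1 + |a|) * (1 + |b|)) := by
  rw [saturate, saturate, div_sub_div _ _ (by positivity) (by positivity)]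
  ring

lemma abs_mul_abs_sub_mul_abs_le (a b : ℝ) :
    |(a * |b| - b * |a|)| ≤ |a - b| * (|a| + |b|) :=
  calc |(a * |b| - b * |a|)| = |((a - b) * (|a| + |b|) + (|b| - |a|) * (a + b)) / 2| := by
        congr 1
        ring
    _ ≤ (|a - b| * (|a| + |b|) + |a - b| * (|a| + |b|)) / 2 := by
        grw [abs_div, abs_two, abs_add_le, abs_mul, abs_mul,
          abs_of_nonneg (a := |a| + |b|) (by positivity),
          abs_abs_sub_abs_le b a, abs_sub_comm b a, abs_add_le a b]
    _ = |a - b| * (|a| + |b|) := by ring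

lemma abs_saturate_sub_saturate_le (a b : ℝ) : |saturate a - saturate b| ≤ |a - b| := by
  rw [saturate_sub_saturate, abs_div, abs_of_nonneg (a := (1 + |a|) * _) (by positivity),
    div_le_iff₀ (by positivity)]
  have h : 0 ≤ |a - b| * (|a| * |b|) := by positivity
  linarith [abs_add_le (a - b) (a * |b| - b * |a|), abs_mul_abs_sub_mul_abs_le a b]

lemma sq_abs_sub_div_le_sub_mul_saturate_sub (a b : ℝ) :
    |a - b| ^ 2 / ((1 + |a|) * (1 + |b|)) ≤ (a - b) * (saturate a - saturate b) := by
  rw [saturate_sub_saturate, mul_div_assoc', sq_abs]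
  gcongr
  rcases abs_cases a with ⟨ha, _⟩ | ⟨ha, _⟩ <;> rcases abs_cases b with ⟨hb, _⟩ | ⟨hb, _⟩ <;>
    rw [ha, hb]
  · nlinarith
  · nlinarith [mul_nonneg (mul_nonneg ‹0 ≤ a› (neg_nonneg.2 ‹b < 0›.le)) (by linarith : 0 ≤ a - b)]
  · nlinarith [mul_nonneg (mul_nonneg (neg_nonneg.2 ‹a < 0›.le) ‹0 ≤ b›) (by linarith : 0 ≤ b - a)]
  · nlinarith

variable {N : ℕ} {Ω : Set (RN N)} {κ s : ℝ} {f u : RN N → ℝ}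

lemma gagliardo_saturate_le {σ p : ℝ} (hp : 0 ≤ p) :
    gagliardo σ p (fun x => saturate (u x)) ≤ gagliardo σ p u := by
  refine lintegral_mono fun z => ENNReal.ofReal_le_ofReal ?_
  gcongr ?_ ^ _ / _
  exact abs_saturate_sub_saturate_le _ _

/-- The integrand of the energy of the `L¹` theory: the quotient of `gagliardo s 2 u`, damped where
`u` is large. -/
noncomputable def dampedEnergyDensity (s : ℝ) (u : RN N → ℝ) (z : RN N × RN N) : ℝ :=
  |u z.1 - u z.2| ^ 2 / ((1 + |u z.1|) * (1 + |u z.2|)) / ‖z.1 - z.2‖ ^ ((N : ℝ) + 2 * s)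

lemma dampedEnergyDensity_nonneg (s : ℝ) (u : RN N → ℝ) (z : RN N × RN N) :
    0 ≤ dampedEnergyDensity s u z := by
  unfold dampedEnergyDensity
  positivity

lemma aemeasurable_dampedEnergyDensity (hu : AEMeasurable u volume) :
    AEMeasurable (dampedEnergyDensity s u) volume := by
  have : AEMeasurable (fun z : RN N × RN N => u z.1) volume :=
    hu.comp_quasiMeasurePreserving Measure.quasiMeasurePreserving_fst
  have : AEMeasurable (fun z : RN N × RN N => u z.2) volume :=
    hu.comp_quasiMeasurePreserving Measure.quasiMeasurePreserving_snd
  unfold dampedEnergyDensity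
  fun_prop

lemma lintegral_dampedEnergyDensity_le_fracForm (hs : 0 ≤ s) (hu : AEStronglyMeasurable u volume)
    (hug : gagliardo s 2 u ≠ ⊤) :
    ∫⁻ z, ENNReal.ofReal (dampedEnergyDensity s u z) ≤
      ENNReal.ofReal (fracForm s u fun x => saturate (u x)) := by
  set F := fun z => diffQuotient s 2 u z * diffQuotient s 2 (fun x => saturate (u x)) z
  have hF : ∀ z, dampedEnergyDensity s u z ≤ F z := fun z => by
    simp only [F, dampedEnergyDensity, diffQuotient]
    rw [div_mul_div_comm,
      ← Real.rpow_add_of_nonneg (norm_nonneg _) (by positivity) (by positivity),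
      show (N : ℝ) / 2 + s + (N / 2 + s) = N + 2 * s by ring]
    gcongr
    exact sq_abs_sub_div_le_sub_mul_saturate_sub _ _
  have hFi : Integrable F := by
    have h₁ := memLp_diffQuotient two_pos hu hug
    have h₂ := memLp_diffQuotient (u := fun x => saturate (u x)) two_pos
      (measurable_saturate.comp_aemeasurable hu.aemeasurable).aestronglyMeasurable
      ((gagliardo_saturate_le zero_le_two).trans_lt hug.lt_top).ne
    rw [ENNReal.ofReal_ofNat] at h₁ h₂
    exact h₁.integrable_mul h₂
  rw [fracForm_eq_integral_diffQuotient hs, ofReal_integral_eq_lintegral_ofReal hFi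
    (.of_forall fun z => (dampedEnergyDensity_nonneg s u z).trans (hF z))]
  exact lintegral_mono fun z => ENNReal.ofReal_le_ofReal (hF z)

lemma fracForm_congr_ae_right {v v' : RN N → ℝ} (h : v =ᵐ[volume] v') :
    fracForm s u v = fracForm s u v' := by
  refine integral_congr_ae ?_
  filter_upwards [Measure.quasiMeasurePreserving_fst.ae_eq_comp h,
    Measure.quasiMeasurePreserving_snd.ae_eq_comp h] with z h₁ h₂
  simp only [Function.comp_apply] at h₁ h₂
  rw [h₁, h₂]

lemma IsDistributionalSolution.mul_lintegral_dampedEnergyDensity_le [NeZero N]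
    (h : IsDistributionalSolution Ω κ s f u) (hΩo : IsOpen Ω) (hΩb : Bornology.IsBounded Ω)
    (hΩ : HasExteriorCorkscrew Ω) (hκ : 0 ≤ κ) (hs0 : 0 < s) (hs1 : s < 1)
    (hf : IntegrableOn f Ω) (hu : MemW0 Ω s 2 u) :
    ENNReal.ofReal κ * ∫⁻ z, ENNReal.ofReal (dampedEnergyDensity s u z) ≤
      ∫⁻ x in Ω, ‖f x * saturate (u x)‖ₑ := by
  have hum := hu.memLp.1
  have hug := hu.gagliardo_lt_top.ne
  set w := hum.mk u
  have hw : Measurable w := hum.stronglyMeasurable_mk.measurable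
  have hwu : u =ᵐ[volume] w := hum.ae_eq_mk
  have hvu : (fun x => saturate (w x)) =ᵐ[volume] fun x => saturate (u x) :=
    hwu.symm.fun_comp saturate
  have key : κ * fracForm s u (fun x => saturate (w x)) = ∫ x in Ω, f x * saturate (w x) := by
    refine h.mul_fracForm_eq hΩo hΩb hΩ hs0 hs1 hf hum hug (by fun_prop)
      (fun x => abs_saturate_le_one (w x)) ?_ ?_
    · rw [gagliardo_congr_ae hvu]
      exact ((gagliardo_saturate_le zero_le_two).trans_lt hug.lt_top).ne
    · filter_upwards [hvu, hu.zero_outside] with x hx hux hxΩ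
      rw [hx, hux hxΩ, saturate, zero_div]
  calc ENNReal.ofReal κ * ∫⁻ z, ENNReal.ofReal (dampedEnergyDensity s u z)
      ≤ ENNReal.ofReal κ * ENNReal.ofReal (fracForm s u fun x => saturate (u x)) := by
        gcongr
        exact lintegral_dampedEnergyDensity_le_fracForm hs0.le hum hug
    _ = ENNReal.ofReal (∫ x in Ω, f x * saturate (u x)) := by
        rw [← ENNReal.ofReal_mul hκ, ← fracForm_congr_ae_right hvu, key]
        congr 1
        exact integral_congr_ae ((ae_restrict_of_ae hvu).mono fun x hx => congrArg (f x * ·) hx)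
    _ ≤ ∫⁻ x in Ω, ‖f x * saturate (u x)‖ₑ :=
        Real.ofReal_le_enorm _ |>.trans (enorm_integral_le_lintegral_enorm _)

end EnergyEstimate

section Reaction

variable {N n : ℕ} {Ω : Set (RN N)} {κ s b γ α lam β : ℝ} {μn u φ : RN N → ℝ}

/-- The integrand `u(y)^{2_b^*} u(x)^{2_b^* - 1} / |x - y|^b` of the Choquard term, at
`z = (x, y)`. -/
noncomputable def choquardDensity (s b : ℝ) (u : RN N → ℝ) (z : RN N × RN N) : ℝ :=
  u z.2 ^ twoStarB N s b * u z.1 ^ (twoStarB N s b - 1) / ‖z.1 - z.2‖ ^ b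

/-- The right-hand side of the equation of `IsWeakSolution`, with the Hardy potential moved to the
right. -/
noncomputable def reaction (Ω : Set (RN N)) (s b γ α lam β : ℝ) (n : ℕ) (μn u : RN N → ℝ)
    (x : RN N) : ℝ :=
  α * (u x / ‖x‖ ^ (2 * s)) + lam * u x + 1 / (u x + 1 / n) ^ γ
    + β * (∫ y in Ω, choquardDensity s b u (x, y)) + μn x

lemma one_lt_twoStar (hs0 : 0 < s) (hN : 2 * s < N) : 1 < twoStar N s := by
  rw [twoStar, one_lt_div (by linarith)]
  linarith

lemma holderConjugate_twoStar (hs0 : 0 < s) (hN : 2 * s < N) :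
    (twoStar N s).HolderConjugate (2 * N / (N + 2 * s)) := by
  have hN0 : (0 : ℝ) < N := by linarith
  refine Real.holderConjugate_iff.2 ⟨one_lt_twoStar hs0 hN, ?_⟩
  rw [twoStar, inv_div, inv_div, ← add_div, div_eq_one_iff_eq (by positivity)]
  ring

lemma lintegral_enorm_le_lintegral_one_add_rpow {r : ℝ} (hr : 1 ≤ r) :
    ∫⁻ x in Ω, ‖u x‖ₑ ≤ ∫⁻ x in Ω, ENNReal.ofReal (1 + |u x| ^ r) := by
  refine lintegral_mono fun x => ?_
  rw [Real.enorm_eq_ofReal_abs]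
  exact ENNReal.ofReal_le_ofReal
    (by simpa using rpow_le_one_add_rpow (abs_nonneg (u x)) zero_le_one hr)

lemma measure_le_lintegral_one_add_rpow (r : ℝ) :
    volume Ω ≤ ∫⁻ x in Ω, ENNReal.ofReal (1 + |u x| ^ r) := by
  rw [← setLIntegral_one]
  exact lintegral_mono fun x => ENNReal.one_le_ofReal.2 (le_add_of_nonneg_right (by positivity))

lemma exists_lintegral_enorm_div_norm_rpow_le [NeZero N] (hΩb : Bornology.IsBounded Ω)
    (hs0 : 0 < s) (hN : 2 * s < N) :
    ∃ C : ℝ≥0∞, C ≠ ⊤ ∧ ∀ u : RN N → ℝ, ∫⁻ x in Ω, ‖u x / ‖x‖ ^ (2 * s)‖ₑ ≤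
      (∫⁻ x in Ω, ENNReal.ofReal (1 + |u x| ^ twoStar N s)) + C := by
  obtain ⟨C, hC, hu⟩ := exists_lintegral_abs_div_norm_rpow_le (volume : Measure (RN N)) hΩb
    (τ := 2 * s) (holderConjugate_twoStar hs0 hN) (by
      rw [finrank_euclideanSpace_fin, mul_div_assoc', div_lt_iff₀ (by positivity)]
      nlinarith)
  refine ⟨C, hC, fun u => ?_⟩
  calc ∫⁻ x in Ω, ‖u x / ‖x‖ ^ (2 * s)‖ₑ
      = ∫⁻ x in Ω, ENNReal.ofReal (|u x| / ‖x‖ ^ (2 * s)) := by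
        refine lintegral_congr fun x => ?_
        rw [Real.enorm_eq_ofReal_abs, abs_div, abs_of_nonneg (a := ‖x‖ ^ _) (by positivity)]
    _ ≤ (∫⁻ x in Ω, ENNReal.ofReal (|u x| ^ twoStar N s)) + C := hu u
    _ ≤ _ := by
        gcongr with x
        linarith

lemma exists_lintegral_enorm_choquardDensity_le [NeZero N] (hΩo : IsOpen Ω)
    (hΩb : Bornology.IsBounded Ω) (hs0 : 0 < s) (hN : 2 * s < N) (hb0 : 0 ≤ b) (hbN : b < N) :
    ∃ C : ℝ≥0∞, C ≠ ⊤ ∧ ∀ u : RN N → ℝ, AEMeasurable u volume → (∀ᵐ x, x ∈ Ω → 0 < u x) →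
      ∫⁻ z in Ω ×ˢ Ω, ‖choquardDensity s b u z‖ₑ ≤
        (∫⁻ x in Ω, ENNReal.ofReal (1 + |u x| ^ twoStar N s)) *
          ((∫⁻ x in Ω, ENNReal.ofReal (1 + |u x| ^ twoStar N s)) + C) := by
  have hNs : (0 : ℝ) < N - 2 * s := by linarith
  have hN0 : (0 : ℝ) < N := by linarith
  obtain ⟨C, hC, hu⟩ := exists_lintegral_rpow_mul_rpow_div_norm_sub_rpow_le
    (volume : Measure (RN N)) hΩo.measurableSet hΩb (q := twoStarB N s b)
    (q' := twoStarB N s b - 1) (r := twoStar N s) (b := b)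
    (by unfold twoStarB; exact div_nonneg (by linarith) hNs.le)
    (by rw [twoStarB, sub_nonneg, one_le_div hNs]; linarith)
    (zero_lt_one.trans (one_lt_twoStar hs0 hN))
    (by unfold twoStarB twoStar; gcongr; linarith)
    (by rw [sub_le_iff_le_add, twoStarB, twoStar, div_add_one hNs.ne']; gcongr; linarith) hb0
    (by rwa [finrank_euclideanSpace_fin])
    (by
      rw [finrank_euclideanSpace_fin, twoStarB, twoStar, div_sub_one hNs.ne',
        div_div_div_cancel_right₀ hNs.ne', div_div_div_cancel_right₀ hNs.ne']
      field_simp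
      linarith)
  refine ⟨C, hC, fun u hum hpos => (lintegral_mono_ae ?_).trans (hu u hum)⟩
  have hpos' : ∀ᵐ z : RN N × RN N, (z.1 ∈ Ω → 0 < u z.1) ∧ (z.2 ∈ Ω → 0 < u z.2) :=
    (Measure.quasiMeasurePreserving_fst.ae hpos).and (Measure.quasiMeasurePreserving_snd.ae hpos)
  filter_upwards [ae_restrict_of_ae hpos', ae_restrict_mem (hΩo.prod hΩo).measurableSet]
    with z hz hzΩ
  have h₁ := hz.1 hzΩ.1
  have h₂ := hz.2 hzΩ.2
  rw [choquardDensity, Real.enorm_of_nonneg (by positivity), abs_of_pos h₁, abs_of_pos h₂]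

lemma aestronglyMeasurable_choquardDensity (hu : AEMeasurable u volume) :
    AEStronglyMeasurable (choquardDensity s b u) volume := by
  have : AEMeasurable (fun z : RN N × RN N => u z.1) volume :=
    hu.comp_quasiMeasurePreserving Measure.quasiMeasurePreserving_fst
  have : AEMeasurable (fun z : RN N × RN N => u z.2) volume :=
    hu.comp_quasiMeasurePreserving Measure.quasiMeasurePreserving_snd
  refine AEMeasurable.aestronglyMeasurable ?_
  unfold choquardDensity
  fun_prop

lemma integrableOn_one_div_add_rpow (hΩ : volume Ω ≠ ⊤) {ε : ℝ} (hε : 0 < ε) (hγ : 0 ≤ γ)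
    (hum : AEMeasurable u volume) (hu : ∀ᵐ x ∂volume.restrict Ω, 0 ≤ u x) :
    IntegrableOn (fun x => 1 / (u x + ε) ^ γ) Ω := by
  refine Measure.integrableOn_of_bounded (M := 1 / ε ^ γ) hΩ ?_ ?_
  · exact (((hum.add_const ε).pow_const γ).const_div 1).aestronglyMeasurable
  · filter_upwards [hu] with x hx
    rw [Real.norm_of_nonneg (by positivity)]
    gcongr
    linarith

/-- The terms of `reaction` are integrable over `Ω`; the Choquard term as a double integral. -/
structure HasIntegrableReaction (Ω : Set (RN N)) (s b γ : ℝ) (n : ℕ) (μn u : RN N → ℝ) :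
    Prop where
  hardy : IntegrableOn (fun x => u x / ‖x‖ ^ (2 * s)) Ω
  linear : IntegrableOn u Ω
  singular : IntegrableOn (fun x => 1 / (u x + 1 / (n : ℝ)) ^ γ) Ω
  choquard : IntegrableOn (choquardDensity s b u) (Ω ×ˢ Ω)
  datum : IntegrableOn μn Ω

namespace HasIntegrableReaction

lemma integrableOn_integral_choquardDensity (h : HasIntegrableReaction Ω s b γ n μn u) :
    IntegrableOn (fun x => ∫ y in Ω, choquardDensity s b u (x, y)) Ω := by
  have hc := h.choquard
  rw [IntegrableOn, Measure.volume_eq_prod, ← Measure.prod_restrict] at hc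
  exact hc.integral_prod_left

lemma integrableOn_reaction (h : HasIntegrableReaction Ω s b γ n μn u) (α lam β : ℝ) :
    IntegrableOn (reaction Ω s b γ α lam β n μn u) Ω :=
  ((((h.hardy.const_mul α).add (h.linear.const_mul lam)).add h.singular).add
    (h.integrableOn_integral_choquardDensity.const_mul β)).add h.datum

lemma integral_integral_choquardDensity_mul (h : HasIntegrableReaction Ω s b γ n μn u)
    (hφ : Continuous φ) (hφc : HasCompactSupport φ) :
    ∫ x in Ω, (∫ y in Ω, choquardDensity s b u (x, y)) * φ x =
      ∫ z in Ω ×ˢ Ω, choquardDensity s b u z * φ z.1 := by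
  obtain ⟨M, hM⟩ := hφc.exists_bound_of_continuous hφ
  have hi : IntegrableOn (fun z : RN N × RN N => choquardDensity s b u z * φ z.1) (Ω ×ˢ Ω) :=
    h.choquard.mul_bdd (c := M) (hφ.comp continuous_fst).aestronglyMeasurable
      (.of_forall fun z => hM z.1)
  rw [Measure.volume_eq_prod] at hi ⊢
  rw [setIntegral_prod _ hi]
  simp only [integral_mul_const]

lemma integral_reaction_mul (h : HasIntegrableReaction Ω s b γ n μn u) (hφ : Continuous φ)
    (hφc : HasCompactSupport φ) :
    ∫ x in Ω, reaction Ω s b γ α lam β n μn u x * φ x =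
      α * (∫ x in Ω, u x / ‖x‖ ^ (2 * s) * φ x) + lam * (∫ x in Ω, u x * φ x)
        + (∫ x in Ω, 1 / (u x + 1 / (n : ℝ)) ^ γ * φ x)
        + β * (∫ z in Ω ×ˢ Ω, choquardDensity s b u z * φ z.1) + ∫ x in Ω, μn x * φ x := by
  obtain ⟨M, hM⟩ := hφc.exists_bound_of_continuous hφ
  have hi : ∀ {g : RN N → ℝ}, IntegrableOn g Ω → IntegrableOn (fun x => g x * φ x) Ω := fun hg =>
    hg.mul_bdd (c := M) hφ.aestronglyMeasurable (.of_forall hM)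
  have h₁ := (hi h.hardy).const_mul α
  have h₂ := (hi h.linear).const_mul lam
  have h₃ := hi h.singular
  have h₄ := (hi h.integrableOn_integral_choquardDensity).const_mul β
  have h₅ := hi h.datum
  rw [← h.integral_integral_choquardDensity_mul hφ hφc, ← integral_const_mul, ← integral_const_mul,
    ← integral_const_mul, ← integral_add' h₁ h₂, ← integral_add' (h₁.add h₂) h₃,
    ← integral_add' ((h₁.add h₂).add h₃) h₄, ← integral_add' (((h₁.add h₂).add h₃).add h₄) h₅]
  refine integral_congr_ae (.of_forall fun x => ?_)
  simp only [reaction, Pi.add_apply]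
  ring

end HasIntegrableReaction

lemma IsWeakSolution.isDistributionalSolution
    (hu : IsWeakSolution Ω κ s b γ α lam β n μn u) (h : HasIntegrableReaction Ω s b γ n μn u) :
    IsDistributionalSolution Ω κ s (reaction Ω s b γ α lam β n μn u) u := fun φ hφ => by
  rw [h.integral_reaction_mul hφ.contDiff.continuous hφ.hasCompactSupport]
  simp only [choquardDensity, div_mul_eq_mul_div, one_mul]
  linarith [hu.weak_form φ hφ]

lemma IsWeakSolution.ae_pos [NeZero N] (hΩo : IsOpen Ω) (hΩb : Bornology.IsBounded Ω)
    (hu : IsWeakSolution Ω κ s b γ α lam β n μn u) : ∀ᵐ x, x ∈ Ω → 0 < u x := by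
  have h : ∀ k : ℕ, ∀ᵐ x, 1 ≤ k * infDist x Ωᶜ → 0 < u x := fun k => by
    obtain ⟨hK, hKΩ⟩ := isCompact_setOf_one_le_mul_infDist_compl hΩb k
    obtain ⟨c, hc, hcu⟩ := hu.locally_pos _ hK hKΩ
    exact ((ae_restrict_iff' hK.measurableSet).1 hcu).mono fun x hx hxK => hc.trans_le (hx hxK)
  filter_upwards [ae_all_iff.2 h] with x hx hxΩ
  have hd := infDist_compl_pos hΩo hΩb hxΩ
  obtain ⟨k, hk⟩ := exists_nat_ge (1 / infDist x Ωᶜ)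
  exact hx k ((div_le_iff₀ hd).1 hk)

lemma IsWeakSolution.hasIntegrableReaction [NeZero N]
    (hu : IsWeakSolution Ω κ s b γ α lam β n μn u) (hΩo : IsOpen Ω) (hΩb : Bornology.IsBounded Ω)
    (hs0 : 0 < s) (hN : 2 * s < N) (hb0 : 0 ≤ b) (hbN : b < N) (hγ : 0 ≤ γ) (hn : 1 ≤ n)
    (hμ : IntegrableOn μn Ω)
    (hur : ∫⁻ x in Ω, ENNReal.ofReal (1 + |u x| ^ twoStar N s) ≠ ⊤) :
    HasIntegrableReaction Ω s b γ n μn u := by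
  have hum := hu.memH.memLp.1.aemeasurable
  have hpos := hu.ae_pos hΩo hΩb
  obtain ⟨C₁, hC₁, h₁⟩ := exists_lintegral_enorm_div_norm_rpow_le hΩb hs0 hN
  obtain ⟨C₂, hC₂, h₂⟩ := exists_lintegral_enorm_choquardDensity_le hΩo hΩb hs0 hN hb0 hbN
  refine ⟨⟨?_, ?_⟩, ⟨hum.aestronglyMeasurable.restrict, ?_⟩,
    integrableOn_one_div_add_rpow hΩb.measure_lt_top.ne ?_ hγ hum ?_,
    ⟨(aestronglyMeasurable_choquardDensity hum).restrict, ?_⟩, hμ⟩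
  · exact (hum.restrict.div (by fun_prop)).aestronglyMeasurable
  · exact (h₁ u).trans_lt (ENNReal.add_lt_top.2 ⟨hur.lt_top, hC₁.lt_top⟩)
  · exact (lintegral_enorm_le_lintegral_one_add_rpow (one_lt_twoStar hs0 hN).le).trans_lt hur.lt_top
  · positivity
  · exact (ae_restrict_iff' hΩo.measurableSet).2 (hpos.mono fun x hx hxΩ => (hx hxΩ).le)
  · exact (h₂ u hum hpos).trans_lt
      (ENNReal.mul_lt_top hur.lt_top (ENNReal.add_lt_top.2 ⟨hur.lt_top, hC₂.lt_top⟩))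

end Reaction

section ReactionBound

variable {N n : ℕ} {Ω : Set (RN N)} {κ s b γ α lam β : ℝ} {μn u : RN N → ℝ}

lemma norm_one_div_add_rpow_mul_saturate_le_one {t ε : ℝ} (ht : 0 ≤ t) (hε : 0 ≤ ε) (hγ0 : 0 ≤ γ)
    (hγ1 : γ ≤ 1) : ‖1 / (t + ε) ^ γ * saturate t‖ ≤ 1 := by
  have key : t ≤ (t + ε) ^ γ * (1 + t) := by
    calc t = t ^ γ * t ^ (1 - γ) := by
          rw [← Real.rpow_add_of_nonneg ht hγ0 (by linarith), add_sub_cancel, Real.rpow_one]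
      _ ≤ (t + ε) ^ γ * (1 + t ^ (1 : ℝ)) := by
          gcongr
          · linarith
          · exact rpow_le_one_add_rpow ht (by linarith) (by linarith)
      _ = (t + ε) ^ γ * (1 + t) := by rw [Real.rpow_one]
  rw [Real.norm_eq_abs, abs_mul, abs_saturate, abs_of_nonneg ht,
    abs_of_nonneg (a := 1 / _) (by positivity), div_mul_div_comm, one_mul]
  exact div_le_one_of_le₀ key (by positivity)

lemma lintegral_enorm_integral_choquardDensity_le (hu : AEMeasurable u volume) :
    ∫⁻ x in Ω, ‖∫ y in Ω, choquardDensity s b u (x, y)‖ₑ ≤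
      ∫⁻ z in Ω ×ˢ Ω, ‖choquardDensity s b u z‖ₑ := by
  have hm : AEMeasurable (fun z => ‖choquardDensity s b u z‖ₑ)
      ((volume.prod volume).restrict (Ω ×ˢ Ω)) :=
    (aestronglyMeasurable_choquardDensity hu).enorm.restrict
  rw [Measure.volume_eq_prod, ← Measure.prod_restrict, lintegral_prod _ (by
    rwa [Measure.prod_restrict])]
  exact lintegral_mono fun x => enorm_integral_le_lintegral_enorm _

lemma enorm_reaction_mul_saturate_le {x : RN N} (hx : 0 ≤ u x) (hγ0 : 0 ≤ γ) (hγ1 : γ ≤ 1) :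
    ‖reaction Ω s b γ α lam β n μn u x * saturate (u x)‖ₑ ≤
      ‖α‖ₑ * ‖u x / ‖x‖ ^ (2 * s)‖ₑ + ‖lam‖ₑ * ‖u x‖ₑ + 1
        + ‖β‖ₑ * ‖∫ y in Ω, choquardDensity s b u (x, y)‖ₑ + ‖μn x‖ₑ := by
  have hsat : ∀ a : ℝ, ‖a * saturate (u x)‖ₑ ≤ ‖a‖ₑ := fun a => enorm_le_iff_norm_le.2 <| by
    rw [norm_mul]
    exact mul_le_of_le_one_right (norm_nonneg a) (abs_saturate_le_one _)
  have hsing : ‖1 / (u x + 1 / (n : ℝ)) ^ γ * saturate (u x)‖ₑ ≤ 1 := by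
    rw [← ofReal_norm, ENNReal.ofReal_le_one]
    exact norm_one_div_add_rpow_mul_saturate_le_one hx (by positivity) hγ0 hγ1
  simp only [reaction, add_mul, ← enorm_mul]
  refine (enorm_add_le _ _).trans (add_le_add ?_ (hsat _))
  refine (enorm_add_le _ _).trans (add_le_add ?_ (hsat _))
  refine (enorm_add_le _ _).trans (add_le_add ?_ hsing)
  exact (enorm_add_le _ _).trans (add_le_add (hsat _) (hsat _))

lemma HasIntegrableReaction.lintegral_enorm_reaction_mul_saturate_le
    (h : HasIntegrableReaction Ω s b γ n μn u) (hum : AEMeasurable u volume)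
    (hu : ∀ᵐ x ∂volume.restrict Ω, 0 ≤ u x) (hγ0 : 0 ≤ γ) (hγ1 : γ ≤ 1) :
    ∫⁻ x in Ω, ‖reaction Ω s b γ α lam β n μn u x * saturate (u x)‖ₑ ≤
      ‖α‖ₑ * (∫⁻ x in Ω, ‖u x / ‖x‖ ^ (2 * s)‖ₑ) + ‖lam‖ₑ * (∫⁻ x in Ω, ‖u x‖ₑ) + volume Ω
        + ‖β‖ₑ * (∫⁻ z in Ω ×ˢ Ω, ‖choquardDensity s b u z‖ₑ) + ∫⁻ x in Ω, ‖μn x‖ₑ := by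
  have hc := h.integrableOn_integral_choquardDensity.1.enorm
  refine (lintegral_mono_ae (hu.mono fun x hx =>
    enorm_reaction_mul_saturate_le hx hγ0 hγ1)).trans ?_
  rw [lintegral_add_right' _ h.datum.1.enorm, lintegral_add_right' _ (hc.const_mul _),
    lintegral_add_right' _ aemeasurable_const,
    lintegral_add_right' _ (h.linear.1.enorm.const_mul _), setLIntegral_one,
    lintegral_const_mul' _ _ enorm_ne_top, lintegral_const_mul' _ _ enorm_ne_top,
    lintegral_const_mul' _ _ enorm_ne_top]
  gcongr
  exact lintegral_enorm_integral_choquardDensity_le hum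

lemma exists_lintegral_dampedEnergyDensity_le [NeZero N] (hΩo : IsOpen Ω)
    (hΩb : Bornology.IsBounded Ω) (hΩ : HasExteriorCorkscrew Ω) (hκ : 0 < κ) (hs0 : 0 < s)
    (hs1 : s < 1) (hN : 2 * s < N) (hb0 : 0 ≤ b) (hbN : b < N) (hγ0 : 0 ≤ γ) (hγ1 : γ ≤ 1)
    (α lam β : ℝ) {I M : ℝ≥0∞} (hI : I ≠ ⊤) (hM : M ≠ ⊤) :
    ∃ A : ℝ≥0∞, A ≠ ⊤ ∧ ∀ (n : ℕ) (μn u : RN N → ℝ), 1 ≤ n → IntegrableOn μn Ω →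
      ∫⁻ x in Ω, ‖μn x‖ₑ ≤ M → IsWeakSolution Ω κ s b γ α lam β n μn u →
      ∫⁻ x in Ω, ENNReal.ofReal (1 + |u x| ^ twoStar N s) ≤ I →
      ∫⁻ z, ENNReal.ofReal (dampedEnergyDensity s u z) ≤ A := by
  obtain ⟨C₁, hC₁, hardy⟩ := exists_lintegral_enorm_div_norm_rpow_le hΩb hs0 hN
  obtain ⟨C₂, hC₂, choquard⟩ := exists_lintegral_enorm_choquardDensity_le hΩo hΩb hs0 hN hb0 hbN
  refine ⟨(‖α‖ₑ * (I + C₁) + ‖lam‖ₑ * I + I + ‖β‖ₑ * (I * (I + C₂)) + M) / ENNReal.ofReal κ,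
    by finiteness, fun n μn u hn hμn hμM hu huI => ?_⟩
  have hum := hu.memH.memLp.1.aemeasurable
  have hpos := hu.ae_pos hΩo hΩb
  have h := hu.hasIntegrableReaction hΩo hΩb hs0 hN hb0 hbN hγ0 hn hμn (ne_top_of_le_ne_top hI huI)
  have henergy := (hu.isDistributionalSolution h).mul_lintegral_dampedEnergyDensity_le hΩo hΩb hΩ
    hκ.le hs0 hs1 (h.integrableOn_reaction α lam β) hu.memH
  have hnonneg : ∀ᵐ x ∂volume.restrict Ω, 0 ≤ u x :=
    (ae_restrict_iff' hΩo.measurableSet).2 (hpos.mono fun x hx hxΩ => (hx hxΩ).le)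
  rw [ENNReal.le_div_iff_mul_le (by simp [hκ]) (by simp), mul_comm]
  refine henergy.trans
    ((h.lintegral_enorm_reaction_mul_saturate_le hum hnonneg hγ0 hγ1).trans ?_)
  gcongr
  · exact (hardy u).trans (by gcongr)
  · exact (lintegral_enorm_le_lintegral_one_add_rpow (one_lt_twoStar hs0 hN).le).trans huI
  · exact (measure_le_lintegral_one_add_rpow _).trans huI
  · exact (choquard u hum hpos).trans (by gcongr)

end ReactionBound

section LowerOrderGagliardo

lemma rpow_div_rpow_le_sq_div_add {a h D d s σ m : ℝ} (ha : 0 ≤ a) (hh : 0 < h) (hD : 0 < D)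
    (hm0 : 0 ≤ m) (hm2 : m < 2) :
    a ^ m / h ^ (d + σ * m) ≤
      a ^ 2 / D / h ^ (d + 2 * s) + D ^ (m / (2 - m)) * h ^ (-(d - 2 * (s - σ) * m / (2 - m))) := by
  have h2m : 0 < 2 - m := by linarith
  set X := a ^ 2 / D / h ^ (d + 2 * s) with hX
  set Y := D ^ (m / (2 - m)) * h ^ (-(d - 2 * (s - σ) * m / (2 - m))) with hY
  have hX0 : 0 ≤ X := by positivity
  have hY0 : 0 ≤ Y := by positivity
  have hXm : X ^ (m / 2) = a ^ m / D ^ (m / 2) / h ^ ((d + 2 * s) * (m / 2)) := by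
    rw [hX, Real.div_rpow (by positivity) (by positivity), Real.div_rpow (by positivity) hD.le,
      ← Real.rpow_mul hh.le, ← Real.rpow_natCast_mul ha]
    congr 3
    push_cast
    ring
  have hYm : Y ^ (1 - m / 2) = D ^ (m / 2) * h ^ ((d + 2 * s) * (m / 2) - (d + σ * m)) := by
    rw [hY, Real.mul_rpow (by positivity) (by positivity), ← Real.rpow_mul hD.le,
      ← Real.rpow_mul hh.le]
    congr 2
    · field_simp
    · field_simp
      ring
  calc a ^ m / h ^ (d + σ * m) = X ^ (m / 2) * Y ^ (1 - m / 2) := by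
        rw [hXm, hYm, Real.rpow_sub hh]
        have := Real.rpow_pos_of_pos hD (m / 2)
        have := Real.rpow_pos_of_pos hh ((d + 2 * s) * (m / 2))
        field_simp
    _ ≤ m / 2 * X + (1 - m / 2) * Y :=
        Real.geom_mean_le_arith_mean2_weighted (by linarith) (by linarith) hX0 hY0 (by ring)
    _ ≤ X + Y := add_le_add (mul_le_of_le_one_left hX0 (by linarith))
        (mul_le_of_le_one_left hY0 (by linarith))

lemma abs_sub_rpow_div_rpow_le {x y h d s σ m : ℝ} (hh : 0 < h) (hm0 : 0 ≤ m) (hm2 : m < 2) :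
    |x - y| ^ m / h ^ (d + σ * m) ≤ |x - y| ^ 2 / ((1 + |x|) * (1 + |y|)) / h ^ (d + 2 * s) +
      2 ^ m * max (1 + |x|) (1 + |y|) ^ (2 * m / (2 - m)) *
        min (h ^ (-(d - 2 * (s - σ) * m / (2 - m)))) (h ^ (-(d + σ * m))) := by
  have h2m : 0 < 2 - m := by linarith
  set w := max (1 + |x|) (1 + |y|)
  have hxw : 1 + |x| ≤ w := le_max_left _ _
  have hyw : 1 + |y| ≤ w := le_max_right _ _
  have hw1 : 1 ≤ w := by linarith [abs_nonneg x]
  have hDw : ((1 + |x|) * (1 + |y|)) ^ (m / (2 - m)) ≤ w ^ (2 * m / (2 - m)) := by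
    calc ((1 + |x|) * (1 + |y|)) ^ (m / (2 - m)) ≤ (w ^ (2 : ℝ)) ^ (m / (2 - m)) := by
          rw [Real.rpow_two, sq]
          gcongr
      _ = w ^ (2 * m / (2 - m)) := by rw [← Real.rpow_mul (by positivity), mul_div_assoc]
  have hsub : |x - y| ^ m ≤ 2 ^ m * w ^ (2 * m / (2 - m)) := by
    calc |x - y| ^ m ≤ (2 * w) ^ m := by
          gcongr
          linarith [abs_sub x y]
      _ = 2 ^ m * w ^ m := Real.mul_rpow zero_le_two (by positivity)
      _ ≤ 2 ^ m * w ^ (2 * m / (2 - m)) := by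
          gcongr
          rw [le_div_iff₀ h2m]
          nlinarith
  rcases min_choice (h ^ (-(d - 2 * (s - σ) * m / (2 - m)))) (h ^ (-(d + σ * m))) with hmin | hmin
  · rw [hmin]
    refine (rpow_div_rpow_le_sq_div_add (s := s) (abs_nonneg _) hh
      (by positivity : 0 < (1 + |x|) * (1 + |y|)) hm0 hm2).trans ?_
    gcongr
    exact hDw.trans (le_mul_of_one_le_left (by positivity) (Real.one_le_rpow one_le_two hm0))
  · rw [hmin, div_eq_mul_inv, Real.rpow_neg hh.le]
    refine le_add_of_nonneg_of_le (by positivity) ?_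
    gcongr

variable {N : ℕ} {Ω : Set (RN N)} {s σ m q r : ℝ} {u : RN N → ℝ}

lemma one_add_rpow_le_two_rpow_mul {a : ℝ} (ha : 0 ≤ a) (hr : 0 ≤ r) (hqr : q ≤ r) :
    (1 + a) ^ q ≤ 2 ^ r * (1 + a ^ r) := by
  calc (1 + a) ^ q ≤ (1 + a) ^ r := Real.rpow_le_rpow_of_exponent_le (by linarith) hqr
    _ ≤ 2 ^ r * (1 ^ r + a ^ r) := add_rpow_le_two_rpow_mul zero_le_one ha hr
    _ = 2 ^ r * (1 + a ^ r) := by rw [Real.one_rpow]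

lemma ofReal_max_rpow_le_indicator_add_indicator {x y : RN N} (hr : 0 ≤ r) (hqr : q ≤ r)
    (hxy : x ∈ Ω ∨ y ∈ Ω) (hx : x ∉ Ω → u x = 0) (hy : y ∉ Ω → u y = 0) :
    ENNReal.ofReal (max (1 + |u x|) (1 + |u y|) ^ q) ≤
      ENNReal.ofReal (2 ^ r) * (Ω.indicator (fun x => ENNReal.ofReal (1 + |u x| ^ r)) x +
        Ω.indicator (fun x => ENNReal.ofReal (1 + |u x| ^ r)) y) := by
  have hmem : ∀ w ∈ Ω, ENNReal.ofReal ((1 + |u w|) ^ q) ≤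
      ENNReal.ofReal (2 ^ r) * Ω.indicator (fun x => ENNReal.ofReal (1 + |u x| ^ r)) w :=
    fun w hw => by
      rw [indicator_of_mem hw, ← ENNReal.ofReal_mul (by positivity)]
      exact ENNReal.ofReal_le_ofReal (one_add_rpow_le_two_rpow_mul (abs_nonneg _) hr hqr)
  rw [mul_add]
  have hmax : y ∈ Ω ∧ max (1 + |u x|) (1 + |u y|) = 1 + |u y| ∨
      x ∈ Ω ∧ max (1 + |u x|) (1 + |u y|) = 1 + |u x| := by
    by_cases hxΩ : x ∈ Ω
    · by_cases hyΩ : y ∈ Ω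
      · exact (max_choice (1 + |u x|) (1 + |u y|)).symm.imp (⟨hyΩ, ·⟩) (⟨hxΩ, ·⟩)
      · exact .inr ⟨hxΩ, max_eq_left (by simp [hy hyΩ])⟩
    · exact .inl ⟨hxy.resolve_left hxΩ, max_eq_right (by simp [hx hxΩ])⟩
  rcases hmax with ⟨hyΩ, h⟩ | ⟨hxΩ, h⟩ <;> rw [h]
  · exact le_add_left (hmem y hyΩ)
  · exact le_add_right (hmem x hxΩ)

lemma ofReal_gagliardo_integrand_le (hm0 : 0 < m) (hm2 : m < 2) (hmr : 2 * m / (2 - m) ≤ r)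
    {z : RN N × RN N} (h₁ : z.1 ∉ Ω → u z.1 = 0) (h₂ : z.2 ∉ Ω → u z.2 = 0) :
    ENNReal.ofReal (|u z.1 - u z.2| ^ m / ‖z.1 - z.2‖ ^ (N + σ * m)) ≤
      ENNReal.ofReal (dampedEnergyDensity s u z) + ENNReal.ofReal (2 ^ m * 2 ^ r) *
        ((Ω.indicator (fun x => ENNReal.ofReal (1 + |u x| ^ r)) z.1 +
          Ω.indicator (fun x => ENNReal.ofReal (1 + |u x| ^ r)) z.2) *
        ENNReal.ofReal (min (‖z.1 - z.2‖ ^ (-(N - 2 * (s - σ) * m / (2 - m))))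
          (‖z.1 - z.2‖ ^ (-(N + σ * m))))) := by
  rcases eq_or_ne z.1 z.2 with heq | hne
  · simp [heq, Real.zero_rpow hm0.ne']
  by_cases hz : z.1 ∈ Ω ∨ z.2 ∈ Ω
  · have hq : 0 ≤ 2 * m / (2 - m) := div_nonneg (by positivity) (by linarith)
    refine (ENNReal.ofReal_le_ofReal (abs_sub_rpow_div_rpow_le (s := s)
      (norm_pos_iff.2 (sub_ne_zero.2 hne)) hm0.le hm2)).trans
      ((ENNReal.ofReal_add_le).trans (add_le_add_right ?_ _))
    rw [ENNReal.ofReal_mul (by positivity), ENNReal.ofReal_mul (by positivity),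
      ENNReal.ofReal_mul (by positivity), mul_assoc (ENNReal.ofReal (2 ^ m)),
      mul_assoc (ENNReal.ofReal (2 ^ m)), ← mul_assoc (ENNReal.ofReal (2 ^ r))]
    gcongr
    exact ofReal_max_rpow_le_indicator_add_indicator (hq.trans hmr) hmr hz h₁ h₂
  · obtain ⟨hz₁, hz₂⟩ := not_or.1 hz
    simp [h₁ hz₁, h₂ hz₂, Real.zero_rpow hm0.ne']

lemma exists_gagliardo_le_lintegral_dampedEnergyDensity_add [NeZero N] (hΩ : MeasurableSet Ω)
    (hσ0 : 0 < σ) (hσs : σ < s) (hm0 : 0 < m) (hm2 : m < 2) (hmr : 2 * m / (2 - m) ≤ r) :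
    ∃ C : ℝ≥0∞, C ≠ ⊤ ∧ ∀ u : RN N → ℝ, AEMeasurable u volume → (∀ᵐ x, x ∉ Ω → u x = 0) →
      gagliardo σ m u ≤ (∫⁻ z, ENNReal.ofReal (dampedEnergyDensity s u z)) +
        C * ∫⁻ x in Ω, ENNReal.ofReal (1 + |u x| ^ r) := by
  set k : RN N → ℝ≥0∞ := fun h => ENNReal.ofReal
    (min (‖h‖ ^ (-(N - 2 * (s - σ) * m / (2 - m)))) (‖h‖ ^ (-(N + σ * m))))
  have hkm : Measurable k := by fun_prop
  have hki : ∫⁻ h, k h < ⊤ := by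
    have h₁ : 0 < 2 * (s - σ) * m / (2 - m) :=
      div_pos (mul_pos (mul_pos two_pos (sub_pos.2 hσs)) hm0) (sub_pos.2 hm2)
    have h₂ : 0 < σ * m := mul_pos hσ0 hm0
    exact lintegral_min_norm_rpow_neg_lt_top volume (by rw [finrank_euclideanSpace_fin]; linarith)
      (by rw [finrank_euclideanSpace_fin]; linarith)
  refine ⟨ENNReal.ofReal (2 ^ m * 2 ^ r) * (2 * ∫⁻ h, k h), by finiteness, fun u hu hu0 => ?_⟩
  set Q : RN N → ℝ≥0∞ := Ω.indicator fun x => ENNReal.ofReal (1 + |u x| ^ r) with hQ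
  have hQm : AEMeasurable Q volume := AEMeasurable.indicator (by fun_prop) hΩ
  have hQ₁ : AEMeasurable (fun z : RN N × RN N => Q z.1 * k (z.1 - z.2)) volume :=
    (hQm.comp_quasiMeasurePreserving Measure.quasiMeasurePreserving_fst).mul (by fun_prop)
  calc gagliardo σ m u
      ≤ ∫⁻ z : RN N × RN N, (ENNReal.ofReal (dampedEnergyDensity s u z) +
          ENNReal.ofReal (2 ^ m * 2 ^ r) * ((Q z.1 + Q z.2) * k (z.1 - z.2))) := by
        refine lintegral_mono_ae ?_
        filter_upwards [Measure.quasiMeasurePreserving_fst.ae hu0,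
          Measure.quasiMeasurePreserving_snd.ae hu0] with z h₁ h₂
        exact ofReal_gagliardo_integrand_le hm0 hm2 hmr h₁ h₂
    _ = (∫⁻ z, ENNReal.ofReal (dampedEnergyDensity s u z)) + ENNReal.ofReal (2 ^ m * 2 ^ r) *
          ((∫⁻ x, Q x) * (∫⁻ h, k h) + (∫⁻ x, Q x) * ∫⁻ h, k h) := by
        simp only [add_mul]
        rw [lintegral_add_left' (aemeasurable_dampedEnergyDensity hu).ennreal_ofReal,
          lintegral_const_mul' _ _ ENNReal.ofReal_ne_top, lintegral_add_left' hQ₁,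
          Measure.volume_eq_prod, lintegral_prod_fst_mul_sub hQm hkm,
          lintegral_prod_snd_mul_sub hQm hkm]
    _ = _ := by
        rw [hQ, lintegral_indicator hΩ]
        ring

end LowerOrderGagliardo

section LowerOrderBound

variable {X : Type*} [MeasurableSpace X] {μ : Measure X} {f : X → ℝ} {r : ℝ}

lemma lintegral_ofReal_one_add_abs_rpow (hr : 0 < r) :
    ∫⁻ x, ENNReal.ofReal (1 + |f x| ^ r) ∂μ = μ univ + eLpNorm f (ENNReal.ofReal r) μ ^ r := by
  have h : ∀ x, ENNReal.ofReal (1 + |f x| ^ r) = 1 + ‖f x‖ₑ ^ r := fun x => by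
    rw [ENNReal.ofReal_add zero_le_one (by positivity), ENNReal.ofReal_one,
      Real.enorm_eq_ofReal_abs, ENNReal.ofReal_rpow_of_nonneg (abs_nonneg _) hr.le]
  simp only [h]
  rw [lintegral_add_left measurable_const, lintegral_one, lintegral_rpow_enorm_eq_rpow_eLpNorm' hr,
    eLpNorm_eq_eLpNorm' (by simpa using hr) ENNReal.ofReal_ne_top, ENNReal.toReal_ofReal hr.le]

variable {N : ℕ} {Ω : Set (RN N)} {s σ m : ℝ} {u : RN N → ℝ}

lemma two_mul_div_two_sub_le_twoStar (hs0 : 0 < s) (hN : 2 * s < N) (hm : m ≤ N / (N - s)) :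
    m < 2 ∧ 2 * m / (2 - m) ≤ twoStar N s := by
  rw [le_div_iff₀ (by linarith)] at hm
  have hm2 : m < 2 := by
    by_contra! h
    nlinarith
  refine ⟨hm2, ?_⟩
  rw [twoStar, div_le_div_iff₀ (by linarith) (by linarith)]
  nlinarith

lemma MemW0.of_exponent_le {p : ℝ} (h : MemW0 Ω s p u) (hΩ : volume Ω ≠ ⊤) (hm : m ≤ p)
    (hu : gagliardo σ m u < ⊤) : MemW0 Ω σ m u := by
  refine ⟨?_, hu, h.zero_outside⟩
  have hind : Ω.indicator u =ᵐ[volume] u := by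
    filter_upwards [h.zero_outside] with x hx
    exact indicator_apply_eq_self.2 hx
  have hm' := ENNReal.ofReal_le_ofReal hm
  exact (memLp_congr_ae hind).1 <| ((memLp_congr_ae hind).2 h.memLp)
    |>.mono_exponent_of_measure_support_ne_top (fun x hx => indicator_of_notMem hx u) hΩ hm'

lemma exists_gagliardo_le_of_isWeakSolution [NeZero N] (hΩo : IsOpen Ω)
    (hΩb : Bornology.IsBounded Ω) (hΩ : HasExteriorCorkscrew Ω) {κ b γ : ℝ} (hκ : 0 < κ)
    (hs0 : 0 < s) (hs1 : s < 1) (hN : 2 * s < N) (hb0 : 0 ≤ b) (hbN : b < N) (hγ0 : 0 ≤ γ)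
    (hγ1 : γ ≤ 1) (α lam β M R : ℝ) (hσ0 : 0 < σ) (hσs : σ < s) (hm0 : 0 < m)
    (hm : m ≤ N / (N - s)) :
    ∃ C : ℝ≥0∞, C ≠ ⊤ ∧ ∀ (n : ℕ) (μn u : RN N → ℝ), 1 ≤ n →
      AEStronglyMeasurable μn (volume.restrict Ω) →
      eLpNorm μn 1 (volume.restrict Ω) ≤ ENNReal.ofReal M →
      IsWeakSolution Ω κ s b γ α lam β n μn u →
      eLpNorm u (ENNReal.ofReal (twoStar N s)) (volume.restrict Ω) ≤ ENNReal.ofReal R →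
      gagliardo σ m u ≤ C := by
  have hr : 0 < twoStar N s := zero_lt_one.trans (one_lt_twoStar hs0 hN)
  obtain ⟨hm2, hmr⟩ := two_mul_div_two_sub_le_twoStar hs0 hN hm
  have hI : volume Ω + ENNReal.ofReal R ^ twoStar N s ≠ ⊤ := ENNReal.add_ne_top.2
    ⟨hΩb.measure_lt_top.ne, ENNReal.rpow_ne_top_of_nonneg hr.le ENNReal.ofReal_ne_top⟩
  obtain ⟨A, hA, energy_le⟩ := exists_lintegral_dampedEnergyDensity_le hΩo hΩb hΩ hκ hs0 hs1 hN hb0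
    hbN hγ0 hγ1 α lam β hI (ENNReal.ofReal_ne_top (r := M))
  obtain ⟨C, hC, gagliardo_le⟩ := exists_gagliardo_le_lintegral_dampedEnergyDensity_add
    hΩo.measurableSet hσ0 hσs hm0 hm2 hmr
  refine ⟨A + C * (volume Ω + ENNReal.ofReal R ^ twoStar N s), by finiteness,
    fun n μn u hn hμm hμM hu huR => ?_⟩
  rw [eLpNorm_one_eq_lintegral_enorm] at hμM
  have huI : ∫⁻ x in Ω, ENNReal.ofReal (1 + |u x| ^ twoStar N s) ≤
      volume Ω + ENNReal.ofReal R ^ twoStar N s := by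
    rw [lintegral_ofReal_one_add_abs_rpow hr, Measure.restrict_apply_univ]
    gcongr
  have hμi : IntegrableOn μn Ω := ⟨hμm, hμM.trans_lt ENNReal.ofReal_lt_top⟩
  exact (gagliardo_le u hu.memH.memLp.1.aemeasurable hu.memH.zero_outside).trans
    (add_le_add (energy_le n μn u hn hμi hμM hu huI) (by gcongr))

end LowerOrderBound

end FracChoquard

open FracChoquard in
theorem mainTheorem3_general {N : ℕ} (Ω : Set (RN N)) (hΩo : IsOpen Ω)
    (hΩb : Bornology.IsBounded Ω) (hΩ : HasExteriorCorkscrew Ω) (κ s b γ α lam β : ℝ) (hκ : 0 < κ)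
    (hs0 : 0 < s) (hs1 : s < 1) (hN : 2 * s < N) (hb0 : 0 ≤ b) (hbN : b < N) (hγ0 : 0 ≤ γ)
    (hγ1 : γ ≤ 1) (μ : ℕ → RN N → ℝ)
    (hμ : ∀ n, 1 ≤ n → AEStronglyMeasurable (μ n) (volume.restrict Ω))
    (hμ1 : ∃ M : ℝ, ∀ n, 1 ≤ n → eLpNorm (μ n) 1 (volume.restrict Ω) ≤ ENNReal.ofReal M)
    (u : ℕ → RN N → ℝ) (hu : ∀ n, 1 ≤ n → IsWeakSolution Ω κ s b γ α lam β n (μ n) (u n))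
    (huR : ∃ R : ℝ, ∀ n, 1 ≤ n →
      eLpNorm (u n) (ENNReal.ofReal (twoStar N s)) (volume.restrict Ω) ≤ ENNReal.ofReal R)
    (σ m : ℝ) (hσ0 : 0 < σ) (hσs : σ < s) (hm0 : 0 < m) (hm : m ≤ N / (N - s)) :
    ∃ C : ℝ, ∀ n, 1 ≤ n → MemW0 Ω σ m (u n) ∧ normW0 σ m (u n) ≤ ENNReal.ofReal C := by
  have : NeZero N := ⟨Nat.cast_ne_zero.1 (by linarith : 0 < (N : ℝ)).ne'⟩
  obtain ⟨M, hM⟩ := hμ1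
  obtain ⟨R, hR⟩ := huR
  obtain ⟨C, hC, gagliardo_le⟩ := exists_gagliardo_le_of_isWeakSolution hΩo hΩb hΩ hκ hs0 hs1 hN hb0
    hbN hγ0 hγ1 α lam β M R hσ0 hσs hm0 hm
  refine ⟨(C ^ (1 / m)).toReal, fun n hn => ?_⟩
  have hg := gagliardo_le n (μ n) (u n) hn (hμ n hn) (hM n hn) (hu n hn) (hR n hn)
  have hm2 := (two_mul_div_two_sub_le_twoStar hs0 hN hm).1.le
  refine ⟨(hu n hn).memH.of_exponent_le hΩb.measure_lt_top.ne hm2 (hg.trans_lt hC.lt_top), ?_⟩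
  rw [ENNReal.ofReal_toReal (ENNReal.rpow_ne_top_of_nonneg (by positivity) hC)]
  exact ENNReal.rpow_le_rpow hg (by positivity)

theorem mainTheorem3 {N : ℕ} (Ω : Set (FracChoquard.RN N))
    (hΩo : IsOpen Ω) (hΩc : IsConnected Ω) (hΩb : Bornology.IsBounded Ω)
    (hΩr : FracChoquard.HasC2Boundary Ω)
    (κ s b γ α lam β : ℝ) (hκ : 0 < κ)
    (hs0 : 0 < s) (hs1 : s < 1) (hN : 2 * s < N)
    (hb0 : 0 < b) (hbN : b < min (N : ℝ) (4 * s))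
    (hγ0 : 0 < γ) (hγ1 : γ < 1) (hα : 0 < α) (hlam : 0 < lam) (hβ : 0 < β)
    (μ : ℕ → FracChoquard.RN N → ℝ)
    (hμ : ∀ n, 1 ≤ n → MemLp (μ n) ⊤ (volume.restrict Ω))
    (hμ1 : ∃ M : ℝ, ∀ n, 1 ≤ n → eLpNorm (μ n) 1 (volume.restrict Ω) ≤ ENNReal.ofReal M)
    (u : ℕ → FracChoquard.RN N → ℝ)
    (hu : ∀ n, 1 ≤ n → FracChoquard.IsWeakSolution Ω κ s b γ α lam β n (μ n) (u n))
    (hu1 : ∀ n, 1 ≤ n → eLpNorm (u n) (ENNReal.ofReal (FracChoquard.twoStar N s))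
      (volume.restrict Ω) = 1) :
    ∀ σ m : ℝ, 0 < σ → σ < s → 1 ≤ m → m < N / (N - s) →
      ∃ C : ℝ, ∀ n, 1 ≤ n →
        FracChoquard.MemW0 Ω σ m (u n) ∧
          FracChoquard.normW0 σ m (u n) ≤ ENNReal.ofReal C := by
  intro σ m hσ0 hσs hm1 hm
  exact mainTheorem3_general Ω hΩo hΩb (hΩr.hasExteriorCorkscrew hΩo hΩb) κ s b γ α lam β hκ hs0 hs1
    hN hb0.le (lt_min_iff.1 hbN).1 hγ0.le hγ1.le μ (fun n hn => (hμ n hn).1) hμ1 u hu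
    ⟨1, fun n hn => by simp [hu1 n hn]⟩ σ m hσ0 hσs (zero_lt_one.trans_le hm1) hm.le
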